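/- For $d\ge 0$ let $LX_d=\mathbb{CP}^{5d+4}$ be the projective space of $5$-tuples $(x_1(\zeta),\dots,x_5(\zeta))$ of complex polynomials of degree $\le d$, with the circle action induced by $\zeta\mapsto \zeta e^{i\phi}$. Let $\hbar$ be the generator of $H^*(BS^1)$, and let $-p$ be the $S^1$-equivariant first Chern class of the Hopf (tautological) line bundle, normalized so that $p$ restricts to $m\hbar$ at the fixed points where only coefficients of $\zeta^m$ are non-zero. Let $LV_d$ be the equivariant bundle of rank $5d+1$ over $LX_d$ of polynomials of degree $\le 5d$ in $\zeta$ twisted by $\mathcal O(5)$, so that $\mathrm{Euler}(LV_d)=\prod_{k=0}^{5d}(5p-k\hbar)$. Put $$L(q,z):=\sum_{d\ge 0} q^d\int_{LX_d} e^{pz}\,\mathrm{Euler}(LV_d),$$ a formal power series in $q,z$ whose coefficients are polynomials in $\hbar$; the integral is evaluation of equivariant cohomology classes on the fundamental class. In the algebra generated by $P$ with the relation $P^4=0$ let $$\langle\phi,\psi\rangle:=\int_{\mathbb{CP}^4}\phi\,\psi\,\mathrm{Euler}(\mathcal O(5))=\frac1{2\pi i}\oint \phi(P)\psi(P)\frac{5P\,dP}{P^5}$$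 (five times the coefficient of $P^3$ in $\phi\psi$), and let $$I(q,\hbar^{-1}):=e^{P\ln q/\hbar}\sum_{d\ge 0}q^d\,\frac{\prod_{m=1}^{5d}(5P+m\hbar)}{\prod_{m=1}^{d}(P+m\hbar)^5},$$ a formal power series in $q$ whose coefficients are polynomials in $\ln q$ over $\mathbb Q(\hbar)[P]/(P^4)$, where $\ln q$ is a formal variable with $q\frac{d}{dq}\ln q=1$ and the substitution $q\mapsto qe^{\hbar z}$ sends $\ln q$ to $\ln q+\hbar z$. Then the two expressions for $\langle\phi,\psi\rangle$ agree, and: (a) $L(q,z)=\langle I(qe^{\hbar z},\hbar^{-1}),\,I(q,-\hbar^{-1})\rangle$, where the pairing is extended coefficientwise (in particular the right-hand side does not contain $\ln q$ and its coefficients are polynomials in $\hbar$). (b) The four components of $I$ (the coefficients of $1,P,P^2,P^3$) form a fundamental solution of the linear differential equation $$\Big(q\frac{d}{dq}\Big)^4 f=5q\Big(5q\frac{d}{dq}+1\Big)\Big(5q\frac{d}{dq}+2\Big)\Big(5q\frac{d}{dq}+3\Big)\Big(5q\frac{d}{dq}+4\Big)f,$$ that is, they are linearly independent over the field of constants and span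 the space of all its solutions among power series in $q$ with coefficients polynomial in $\ln q$. This holds over every field of constants $K$ of characteristic zero, for $\hbar$ any non-zero element of $K$ (for example $K=\mathbb Q(\hbar)$). -/

import Mathlib

namespace QuinticMirror

open Polynomial PowerSeries MeasureTheory

noncomputable section

/-! ### Equivariant differential forms on complex projective space

`ℂP^N` is the space of lines in `ℂ^(N+1)`.  The circle acts on `ℂ^(N+1)`, hence on `ℂP^N`, by
multiplying the `j`-th homogeneous coordinate by `exp (i t w_j)`.  Equivariant cohomology classes
are represented by equivariant differential forms (the Cartan model): polynomials in the generator
`ħ` of `H^*(BS¹)` whose coefficients are differential forms.  Forms on `ℂP^N` are written in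
homogeneous coordinates, that is, they are pulled back to `ℂ^(N+1) ∖ {0}`. -/

/-- The space `ℂ^(N+1)` of homogeneous coordinates on `ℂP^N`. -/
abbrev HomCoord (N : ℕ) : Type := Fin (N + 1) → ℂ

/-- Values of differential forms: the exterior algebra of the real cotangent space. -/
abbrev Form (N : ℕ) : Type := ExteriorAlgebra ℝ (HomCoord N →L[ℝ] ℝ)

/-- Equivariant differential forms: polynomials in `ħ` (the polynomial variable) whose
coefficients are fields of differential forms; multiplication is the wedge product. -/
abbrev EquivForm (N : ℕ) : Type := Polynomial (HomCoord N → Form N)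

/-- The coordinate covector `d (Re x_j)`. -/
def dRe {N : ℕ} (j : Fin (N + 1)) : HomCoord N →L[ℝ] ℝ :=
  Complex.reCLM.comp (ContinuousLinearMap.proj j)

/-- The coordinate covector `d (Im x_j)`. -/
def dIm {N : ℕ} (j : Fin (N + 1)) : HomCoord N →L[ℝ] ℝ :=
  Complex.imCLM.comp (ContinuousLinearMap.proj j)

/-- The exterior derivative of a 1-form, `∑ dx_a ∧ ∂_a θ` over the real coordinates `x_a`. -/
def extD {N : ℕ} (θ : HomCoord N → (HomCoord N →L[ℝ] ℝ)) : HomCoord N → Form N := fun x =>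
  ∑ j : Fin (N + 1),
    (ExteriorAlgebra.ι ℝ (dRe j) * ExteriorAlgebra.ι ℝ (fderiv ℝ θ x (Pi.single j 1)) +
      ExteriorAlgebra.ι ℝ (dIm j) * ExteriorAlgebra.ι ℝ (fderiv ℝ θ x (Pi.single j Complex.I)))

/-- The connection 1-form `Im ⟨x, dx⟩ / (2π ‖x‖²)` of the Hopf bundle `ℂ^(N+1) ∖ {0} → ℂP^N`
with its standard Hermitian metric. -/
def hopfConnection {N : ℕ} (x : HomCoord N) : HomCoord N →L[ℝ] ℝ :=
  (2 * Real.pi * ∑ j, Complex.normSq (x j))⁻¹ • ∑ j, ((x j).re • dIm j - (x j).im • dRe j)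

/-- The circle action with weights `w`. -/
def rotate {N : ℕ} (w : Fin (N + 1) → ℕ) (t : ℝ) (x : HomCoord N) : HomCoord N :=
  fun j => Complex.exp (Complex.I * t * w j) * x j

/-- The vector field generating the circle action with weights `w`. -/
def generator {N : ℕ} (w : Fin (N + 1) → ℕ) (x : HomCoord N) : HomCoord N :=
  deriv (fun t : ℝ => rotate w t x) 0

/-- The generator `ħ` of `H^*(BS¹)`, as an equivariant form. -/
def hbarForm {N : ℕ} : EquivForm N := Polynomial.X

/-- The equivariant form representing the class `p`, where `-p` is the equivariant first Chern
class of the Hopf (tautological) line bundle: it is the equivariant curvature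
`dθ + 2π ħ θ(ξ)` of the invariant connection form `θ`, with `ξ` the generating vector field.  The
normalization is such that `p` is Poincaré dual to a hyperplane when `ħ = 0`, and that it restricts
to `w_j ħ` at the fixed point where only the `j`-th coordinate is non-zero. -/
def pForm {N : ℕ} (w : Fin (N + 1) → ℕ) : EquivForm N :=
  Polynomial.C (extD hopfConnection) +
    Polynomial.C (fun x =>
      algebraMap ℝ (Form N) (2 * Real.pi * hopfConnection x (generator w x))) * hbarForm

/-- Evaluation of (the degree `m` component of) a form on the vectors `v 0, …, v (m - 1)`;
on a product of covectors it is `det (φ_i (v_j))`. -/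
def evalForm {N m : ℕ} (v : Fin m → HomCoord N) : Form N →ₗ[ℝ] ℝ :=
  ExteriorAlgebra.liftAlternating (R := ℝ) (Pi.single m
    ((Matrix.detRowAlternating (R := ℝ) (n := Fin m)).compLinearMap
      (LinearMap.pi fun j =>
        (ContinuousLinearMap.coeLM ℝ : (HomCoord N →L[ℝ] ℝ) →ₗ[ℝ] (HomCoord N →ₗ[ℝ] ℝ)).flip
          (v j))))

/-- The affine chart `u ↦ [1 : u_1 : … : u_N]` of `ℂP^N`, with complement of measure zero. -/
def chart {N : ℕ} (u : Fin N → ℂ) : HomCoord N := Fin.cons 1 u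

/-- The oriented real frame `e_1, i e_1, …, e_N, i e_N` of the affine chart. -/
def chartFrame (N : ℕ) (a : Fin (N * 2)) : HomCoord N :=
  Pi.single (finProdFinEquiv.symm a).1.succ (if (finProdFinEquiv.symm a).2 = 0 then 1 else Complex.I)

/-- The integral over `ℂP^N` of (the top-degree component of) a differential form. -/
def projIntegral {N : ℕ} (α : HomCoord N → Form N) : ℝ :=
  ∫ u : Fin N → ℂ, evalForm (chartFrame N) (α (chart u))

/-- The integral over `ℂP^N` of an equivariant form, with values in `H^*(BS¹) = ℝ[ħ]`. -/
def equivIntegral {N : ℕ} (α : EquivForm N) : ℝ[X] :=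
  α.sum fun k a => Polynomial.monomial k (projIntegral a)

/-! ### The linear sigma-model

`LX_d = ℂP^(5d+4)` is the projective space of 5-tuples of polynomials of degree `≤ d` in `ζ`;
the homogeneous coordinate with index `5 k + i`, `0 ≤ i < 5`, is the coefficient of `ζ^k` in the
`i`-th polynomial.  The circle acts by `ζ ↦ ζ exp (i t)`. -/

/-- The weights of the circle action on `LX_d`: the coefficients of `ζ^k` have weight `k`. -/
def sigmaWeight (d : ℕ) (a : Fin (5 * d + 4 + 1)) : ℕ := (a : ℕ) / 5

/-- The class `p` on `LX_d`. -/
def pLX (d : ℕ) : EquivForm (5 * d + 4) := pForm (sigmaWeight d)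

/-- The equivariant Euler class of the bundle `LV_d` of rank `5d+1` over `LX_d`, whose fibres are
the polynomials of degree `≤ 5d` in `ζ` twisted by `𝒪(5)`.  It is the direct sum of the line
bundles of coefficients of `ζ^k`, `0 ≤ k ≤ 5d`, with equivariant Chern classes `5p - kħ`. -/
def eulerLV (d : ℕ) : EquivForm (5 * d + 4) :=
  ((List.range (5 * d + 1)).map fun k => 5 * pLX d - (k : EquivForm (5 * d + 4)) * hbarForm).prod

/-- The series `L(q, z) = ∑ q^d ∫_{LX_d} e^{pz} Euler(LV_d)`; the outer power series variable is
`q`, the inner one is `z`, and the coefficients are polynomials in `ħ`. -/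
def LSeries : ℝ[X]⟦X⟧⟦X⟧ :=
  PowerSeries.mk fun d => PowerSeries.mk fun n =>
    equivIntegral (((n.factorial : ℝ)⁻¹ • pLX d ^ n) * eulerLV d)

/-! ### The cohomology algebra of the quintic and the hypergeometric series -/

/-- The algebra `K[P]/(P^4)`. -/
abbrev QuinticAlg (K : Type*) [Field K] : Type _ := AdjoinRoot (Polynomial.X ^ 4 : K[X])

/-- The generator `P`. -/
def clsP (K : Type*) [Field K] : QuinticAlg K := AdjoinRoot.root (Polynomial.X ^ 4 : K[X])

/-- The coefficient of `P^j` (`j < 4`) of an element of `K[P]/(P^4)`. -/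
def comp {K : Type*} [Field K] (j : ℕ) : QuinticAlg K →ₗ[K] K :=
  (Polynomial.lcoeff K j).comp (AdjoinRoot.modByMonicHom (Polynomial.monic_X_pow 4))

/-- The functional `φ ↦ ∫_{ℂP^4} φ Euler(𝒪(5)) = Res φ(P) 5P dP / P^5`: five times the
coefficient of `P^3`. -/
def quinticInt {K : Type*} [Field K] : QuinticAlg K →ₗ[K] K := (5 : K) • comp 3

/-- The intersection pairing on `K[P]/(P^4)`. -/
def pairing {K : Type*} [Field K] (φ ψ : QuinticAlg K) : K := quinticInt (φ * ψ)

/-- A linear functional on `K[P]/(P^4)` applied to the coefficients of a polynomial in `ℓ`. -/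
def polyMap {K : Type*} [Field K] (f : QuinticAlg K →ₗ[K] K) (g : (QuinticAlg K)[X]) : K[X] :=
  g.sum fun n a => Polynomial.monomial n (f a)

/-- The intersection pairing extended coefficientwise to power series in `q` (outer variable) and
`z` (inner variable) whose coefficients are polynomials in `ℓ = ln q` over `K[P]/(P^4)`. -/
def pairingSeries {K : Type*} [Field K] (φ ψ : (QuinticAlg K)[X]⟦X⟧⟦X⟧) : K[X]⟦X⟧⟦X⟧ :=
  PowerSeries.mk fun d => PowerSeries.mk fun n =>
    polyMap quinticInt (PowerSeries.coeff n (PowerSeries.coeff d (φ * ψ)))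

/-- The factor `e^{P ℓ / h}`, `ℓ = ln q`, a polynomial in `ℓ` because `P^4 = 0`. -/
def expLog {K : Type*} [Field K] (h : K) : (QuinticAlg K)[X] :=
  ∑ j ∈ Finset.range 4,
    Polynomial.monomial j (algebraMap K (QuinticAlg K) ((j.factorial : K)⁻¹ * h⁻¹ ^ j) * clsP K ^ j)

/-- The coefficient
`(5P + h)(5P + 2h)⋯(5P + 5dh) / ((P + h)^5 (P + 2h)^5 ⋯ (P + dh)^5)` in `K[P]/(P^4)`. The
denominator is a unit whenever `h ≠ 0` and `K` has characteristic zero. -/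
def hyperCoeff {K : Type*} [Field K] (h : K) (d : ℕ) : QuinticAlg K :=
  (∏ m ∈ Finset.Icc 1 (5 * d), (5 * clsP K + algebraMap K (QuinticAlg K) (m * h))) *
    Ring.inverse (∏ m ∈ Finset.Icc 1 d, (clsP K + algebraMap K (QuinticAlg K) (m * h)) ^ 5)

/-- The hypergeometric series `I(q, h⁻¹)`, a power series in `q` whose coefficients are
polynomials in `ℓ = ln q` over `K[P]/(P^4)`. -/
def ISeries {K : Type*} [Field K] (h : K) : (QuinticAlg K)[X]⟦X⟧ :=
  PowerSeries.C (expLog h) * PowerSeries.mk fun d => Polynomial.C (hyperCoeff h d)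

/-- The power series `e^{a z}` in `z`. -/
def expZ {K : Type*} [Field K] (a : K) : (QuinticAlg K)[X]⟦X⟧ :=
  PowerSeries.mk fun n => algebraMap K (QuinticAlg K)[X] ((n.factorial : K)⁻¹ * a ^ n)

/-- The substitution `q ↦ q e^{hz}` in `f(q, ln q)`: `q^d ↦ q^d e^{dhz}` and `ℓ ↦ ℓ + hz`. -/
def shiftQ {K : Type*} [Field K] (h : K) (f : (QuinticAlg K)[X]⟦X⟧) :
    (QuinticAlg K)[X]⟦X⟧⟦X⟧ :=
  PowerSeries.mk fun d =>
    (PowerSeries.coeff d f).eval₂ (PowerSeries.C.comp Polynomial.C)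
      (PowerSeries.C Polynomial.X +
        PowerSeries.C (algebraMap K (QuinticAlg K)[X] h) * PowerSeries.X) *
    expZ (d * h)

/-- A series in `q` regarded as a series in `q` and `z` that does not depend on `z`. -/
def constZ {K : Type*} [Field K] (f : (QuinticAlg K)[X]⟦X⟧) : (QuinticAlg K)[X]⟦X⟧⟦X⟧ :=
  PowerSeries.map PowerSeries.C f

/-! ### The differential equation -/

/-- The operator `q d/dq` on power series in `q` with coefficients polynomial in `ℓ = ln q`. -/
def qDeriv (K : Type*) [Field K] : Module.End K K[X]⟦X⟧ where
  toFun f := PowerSeries.mk fun d =>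
    (d : K) • PowerSeries.coeff d f + Polynomial.derivative (PowerSeries.coeff d f)
  map_add' f g := by
    ext1 d
    simp only [map_add, smul_add, PowerSeries.coeff_mk]
    abel
  map_smul' c f := by
    ext1 d
    simp only [PowerSeries.coeff_mk, PowerSeries.coeff_smul, RingHom.id_apply,
      Polynomial.derivative_smul, smul_add, smul_comm c]

/-- Multiplication by `q`. -/
def mulQ (K : Type*) [Field K] : Module.End K K[X]⟦X⟧ :=
  LinearMap.mulLeft K (PowerSeries.X : K[X]⟦X⟧)

/-- The space of solutions of the fourth-order equation
`(q d/dq)^4 f = 5q (5q d/dq + 1)(5q d/dq + 2)(5q d/dq + 3)(5q d/dq + 4) f`. -/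
def solutionSpace (K : Type*) [Field K] : Submodule K K[X]⟦X⟧ :=
  LinearMap.ker (qDeriv K ^ 4 -
    5 * mulQ K * (5 * qDeriv K + 1) * (5 * qDeriv K + 2) * (5 * qDeriv K + 3) * (5 * qDeriv K + 4))

/-- The components of `I`: the coefficients of `1, P, P^2, P^3`. -/
def IComponent {K : Type*} [Field K] (h : K) (j : Fin 4) : K[X]⟦X⟧ :=
  PowerSeries.mk fun d => polyMap (comp j) (PowerSeries.coeff d (ISeries h))

end

end QuinticMirror

namespace QuinticMirror

open Polynomial PowerSeries MeasureTheory

noncomputable section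

/-! ### The differential equation -/

section DifferentialEquation

variable {K : Type*} [Field K]

/-! Both sides of (a) are compared through one algebraic functional, `resInfty`: the coefficient of
`p⁻¹` in the expansion at infinity of `F(p) / ∏ (p - w)`.

Geometric side. The equivariant curvature is `ω + μħ`, with `ω` the Fubini–Study 2-form and `μ` the
moment map. Only `ω ^ N` has top degree, so integrating `p ^ n` gives `n.choose N` times the moment
of order `n - N` of `μ` against the volume form. Dirichlet integrals identify these with the
complete homogeneous symmetric functions of the weights, which are the expansion coefficients of `1
/ ∏ (p - w_j ħ)`. This is `equivIntegral_evalP`; no localization theorem is used.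

Algebraic side. On `LX_d` each weight `kħ`, `k ≤ d`, occurs five times, but the Euler class contains
`5p - 5kħ`, so only poles of order four remain. Over a field containing `ħ`, partial fractions
(`resInfty_eq_sum`) turn the residue at infinity into a sum of local residues, computed in
`K[P]/(P^4)` with `p = P + kħ`. Seen from the `k`-th pole, the factors with positive shift form the
`k`-th coefficient of `I` at `ħ`, those with negative shift the `(d-k)`-th coefficient at `-ħ`
(`aeval_euler_mul_inverse`). The sum over `k` is the Cauchy product in the pairing, once the
exponential factors have been combined (`coeff_shiftQ_mul_constZ`).

For (b), on a coefficient of `q ^ d` of the form `e^{Pℓ/h} y` the operator `q d/dq` is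
multiplication of `y` by `(P + dh)/h`. The equation becomes the recursion `hyperCoeff_succ` together
with `P^4 = 0` at `d = 0`. Conversely `d + ∂` is injective on polynomials in `ℓ` for `d ≥ 1`, so a
solution is determined by its `q ^ 0` coefficient, a polynomial of degree at most three in `ℓ`; the
four components of `I` start with nonzero multiples of `1, ℓ, ℓ², ℓ³`. -/

theorem clsP_pow_four : clsP K ^ 4 = 0 := by
  have := AdjoinRoot.mk_self (f := (Polynomial.X ^ 4 : K[X]))
  rwa [map_pow, AdjoinRoot.mk_X] at this

theorem comp_mk {j : ℕ} (hj : j < 4) (g : K[X]) :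
    comp j (AdjoinRoot.mk (Polynomial.X ^ 4 : K[X]) g) = g.coeff j := by
  have h1 : comp j (AdjoinRoot.mk (Polynomial.X ^ 4 : K[X]) g) =
      (g %ₘ (Polynomial.X ^ 4)).coeff j := by
    simp [comp, AdjoinRoot.modByMonicHom_mk]
  rw [h1]
  conv_rhs => rw [← Polynomial.modByMonic_add_div g (Polynomial.X ^ 4 : K[X])]
  rw [Polynomial.coeff_add, Polynomial.coeff_X_pow_mul', if_neg (by omega), add_zero]

theorem comp_algebraMap_mul_clsP_pow {j : ℕ} (hj : j < 4) (c : K) (i : ℕ) :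
    comp j (algebraMap K (QuinticAlg K) c * clsP K ^ i) = if j = i then c else 0 := by
  have : algebraMap K (QuinticAlg K) c * clsP K ^ i =
      AdjoinRoot.mk (Polynomial.X ^ 4 : K[X]) (Polynomial.C c * Polynomial.X ^ i) := by
    rw [map_mul, map_pow, AdjoinRoot.mk_X, AdjoinRoot.mk_C]; rfl
  rw [this, comp_mk hj, Polynomial.coeff_C_mul_X_pow]

/-- `P + c` is invertible in `K[P]/(P^4)` for `c ≠ 0`. -/
theorem isUnit_clsP_add {c : K} (hc : c ≠ 0) :
    IsUnit (clsP K + algebraMap K (QuinticAlg K) c) := by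
  have h1 : IsUnit (algebraMap K (QuinticAlg K) c) := (IsUnit.mk0 c hc).map _
  have h2 : IsNilpotent (clsP K) := ⟨4, clsP_pow_four⟩
  rw [add_comm]
  exact h2.isUnit_add_left_of_commute h1 (Commute.all _ _)

theorem coeff_polyMap (f : QuinticAlg K →ₗ[K] K) (g : (QuinticAlg K)[X]) (n : ℕ) :
    (polyMap f g).coeff n = f (g.coeff n) := by
  rw [polyMap, Polynomial.sum, Polynomial.finsetSum_coeff]
  simp only [Polynomial.coeff_monomial]
  rw [Finset.sum_ite_eq']
  split_ifs with h
  · rfl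
  · rw [Polynomial.notMem_support_iff.mp h, map_zero]

/-- `polyMap f` as a linear map. -/
def polyMapₗ (f : QuinticAlg K →ₗ[K] K) : (QuinticAlg K)[X] →ₗ[K] K[X] where
  toFun := polyMap f
  map_add' a b := by ext n; simp [coeff_polyMap]
  map_smul' a b := by ext n; simp [coeff_polyMap]

theorem derivative_polyMap (f : QuinticAlg K →ₗ[K] K) (g : (QuinticAlg K)[X]) :
    derivative (polyMap f g) = polyMap f (derivative g) := by
  ext n
  rw [coeff_polyMap, Polynomial.coeff_derivative, Polynomial.coeff_derivative, coeff_polyMap]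
  have : g.coeff (n + 1) * ((n : QuinticAlg K) + 1) = ((n : K) + 1) • g.coeff (n + 1) := by
    rw [Algebra.smul_def, mul_comm]; simp
  rw [this, map_smul, smul_eq_mul, mul_comm]

theorem polyMap_smul (f : QuinticAlg K →ₗ[K] K) (c : K) (g : (QuinticAlg K)[X]) :
    polyMap f (c • g) = c • polyMap f g := (polyMapₗ f).map_smul c g

theorem polyMap_add (f : QuinticAlg K →ₗ[K] K) (g g' : (QuinticAlg K)[X]) :
    polyMap f (g + g') = polyMap f g + polyMap f g' := (polyMapₗ f).map_add g g'

/-- Valid for every `n`, also beyond the truncation, because `P ^ n = 0` for `n ≥ 4`. The truncated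
sum may thus be handled as a full exponential. -/
theorem expLog_coeff (h : K) (n : ℕ) :
    (expLog h).coeff n =
      algebraMap K (QuinticAlg K) ((n.factorial : K)⁻¹ * h⁻¹ ^ n) * clsP K ^ n := by
  rw [expLog, Polynomial.finsetSum_coeff]
  simp only [Polynomial.coeff_monomial]
  rw [Finset.sum_ite_eq']
  split_ifs with hn
  · rfl
  · rw [Finset.mem_range, not_lt] at hn
    rw [← Nat.sub_add_cancel hn, pow_add (clsP K), clsP_pow_four]; simp

theorem derivative_expLog [CharZero K] (h : K) :
    derivative (expLog h) = Polynomial.C (h⁻¹ • clsP K) * expLog h := by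
  ext n
  rw [Polynomial.coeff_derivative, Polynomial.coeff_C_mul, expLog_coeff, expLog_coeff,
    Algebra.smul_def, Nat.factorial_succ]
  have h1 : ((n : QuinticAlg K) + 1) = algebraMap K (QuinticAlg K) ((n : K) + 1) := by simp
  have h2 : ((n : K) + 1) ≠ 0 := by exact_mod_cast Nat.succ_ne_zero n
  rw [h1]
  have h3 : ((((n + 1) * n.factorial : ℕ) : K)⁻¹ * h⁻¹ ^ (n + 1)) * ((n : K) + 1) =
      h⁻¹ * ((n.factorial : K)⁻¹ * h⁻¹ ^ n) := by
    push_cast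
    rw [mul_inv, pow_succ]; field_simp
  calc _ = algebraMap K (QuinticAlg K) (((((n + 1) * n.factorial : ℕ) : K)⁻¹ * h⁻¹ ^ (n + 1)) *
        ((n : K) + 1)) * clsP K ^ (n + 1) := by rw [map_mul _ _ ((n : K) + 1)]; ring
    _ = _ := by rw [h3, map_mul]; ring

theorem hyperCoeff_zero (h : K) : hyperCoeff h 0 = 1 := by simp [hyperCoeff]

theorem isUnit_hyperDenom [CharZero K] {h : K} (hh : h ≠ 0) (d : ℕ) :
    IsUnit (∏ m ∈ Finset.Icc 1 d, (clsP K + algebraMap K (QuinticAlg K) (m * h)) ^ 5) := by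
  rw [IsUnit.prod_iff]
  intro m hm
  have : m ≠ 0 := by have := (Finset.mem_Icc.mp hm).1; omega
  exact (isUnit_clsP_add (mul_ne_zero (by exact_mod_cast this) hh)).pow 5

theorem hyperCoeff_mul_denom [CharZero K] {h : K} (hh : h ≠ 0) (d : ℕ) :
    hyperCoeff h d * ∏ m ∈ Finset.Icc 1 d, (clsP K + algebraMap K (QuinticAlg K) (m * h)) ^ 5 =
      ∏ m ∈ Finset.Icc 1 (5 * d), (5 * clsP K + algebraMap K (QuinticAlg K) (m * h)) := by
  rw [hyperCoeff, mul_assoc, Ring.inverse_mul_cancel _ (isUnit_hyperDenom hh d), mul_one]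

/-- The recursion satisfied by the coefficients of the hypergeometric series. -/
theorem hyperCoeff_succ [CharZero K] {h : K} (hh : h ≠ 0) (d : ℕ) :
    (clsP K + algebraMap K (QuinticAlg K) ((d + 1 : ℕ) * h)) ^ 4 * hyperCoeff h (d + 1) =
      5 * ((5 * clsP K + algebraMap K (QuinticAlg K) ((5 * d + 1 : ℕ) * h)) *
      (5 * clsP K + algebraMap K (QuinticAlg K) ((5 * d + 2 : ℕ) * h)) *
      (5 * clsP K + algebraMap K (QuinticAlg K) ((5 * d + 3 : ℕ) * h)) *
      (5 * clsP K + algebraMap K (QuinticAlg K) ((5 * d + 4 : ℕ) * h))) * hyperCoeff h d := by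
  have h1 := hyperCoeff_mul_denom hh d
  have h2 := hyperCoeff_mul_denom hh (d + 1)
  have e : 5 * (d + 1) = 5 * d + 1 + 1 + 1 + 1 + 1 := by ring
  rw [e, Finset.prod_Icc_succ_top (by omega), Finset.prod_Icc_succ_top (by omega),
    Finset.prod_Icc_succ_top (by omega), Finset.prod_Icc_succ_top (by omega),
    Finset.prod_Icc_succ_top (by omega), Finset.prod_Icc_succ_top (by omega), ← h1] at h2
  -- The last of the five new numerator factors is five times the base of the new denominator
  -- factor. It cancels one of five powers, which leaves the fourth power on the left and the
  -- constant 5 on the right.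
  have h5 : 5 * clsP K + algebraMap K (QuinticAlg K) ((5 * d + 1 + 1 + 1 + 1 + 1 : ℕ) * h) =
      5 * (clsP K + algebraMap K (QuinticAlg K) ((d + 1 : ℕ) * h)) := by
    simp only [map_mul, map_natCast]; push_cast; ring
  rw [h5] at h2
  have u1 := isUnit_hyperDenom hh d
  have u2 : IsUnit (clsP K + algebraMap K (QuinticAlg K) ((d + 1 : ℕ) * h)) :=
    isUnit_clsP_add (mul_ne_zero (by exact_mod_cast Nat.succ_ne_zero d) hh)
  apply (u1.mul u2).mul_left_injective
  dsimp only
  linear_combination h2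

/-- The operator `d + ∂` on polynomials in `ℓ`: the action of `q d/dq` on the coefficient
of `q^d`. -/
def shiftDeriv (K : Type*) [Field K] (d : ℕ) : Module.End K K[X] :=
  (d : K) • 1 + Polynomial.derivative

theorem coeff_qDeriv (f : K[X]⟦X⟧) (d : ℕ) :
    PowerSeries.coeff d (qDeriv K f) = shiftDeriv K d (PowerSeries.coeff d f) := by
  simp [qDeriv, shiftDeriv]

theorem coeff_qDeriv_pow (f : K[X]⟦X⟧) (d n : ℕ) :
    PowerSeries.coeff d ((qDeriv K ^ n) f) = (shiftDeriv K d ^ n) (PowerSeries.coeff d f) := by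
  induction n generalizing f with
  | zero => simp
  | succ n ih => rw [pow_succ, pow_succ, Module.End.mul_apply, Module.End.mul_apply, ih,
      coeff_qDeriv]

/-- `(5(d+∂)+1)(5(d+∂)+2)(5(d+∂)+3)(5(d+∂)+4)`. -/
def picardFuchsRight (K : Type*) [Field K] (d : ℕ) : Module.End K K[X] :=
  (5 * shiftDeriv K d + 1) * (5 * shiftDeriv K d + 2) * (5 * shiftDeriv K d + 3) *
    (5 * shiftDeriv K d + 4)

/-- Multiplication by `q` links the coefficient of `q ^ (d+1)` on the left to that of `q ^ d` on the
right; at `q ^ 0` the right side vanishes and `q d/dq` is just `∂`. -/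
theorem mem_solutionSpace_iff (f : K[X]⟦X⟧) :
    f ∈ solutionSpace K ↔ (derivative^[4] (PowerSeries.coeff 0 f) = 0 ∧
      ∀ d, (shiftDeriv K (d + 1) ^ 4) (PowerSeries.coeff (d + 1) f) =
        5 • picardFuchsRight K d (PowerSeries.coeff d f)) := by
  rw [solutionSpace, LinearMap.mem_ker, LinearMap.sub_apply, sub_eq_zero, PowerSeries.ext_iff]
  simp only [Module.End.mul_apply, coeff_qDeriv_pow, LinearMap.add_apply, Module.End.ofNat_apply,
    Module.End.one_apply, map_nsmul, mulQ, LinearMap.mulLeft_apply]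
  rw [← Nat.and_forall_add_one]
  refine and_congr ?_ (forall_congr' fun d => ?_)
  · simp [shiftDeriv, Module.End.pow_apply]
  · simp only [PowerSeries.coeff_succ_X_mul, picardFuchsRight, Module.End.mul_apply,
      LinearMap.add_apply, Module.End.ofNat_apply, Module.End.one_apply, map_add, map_nsmul,
      coeff_qDeriv]
    refine iff_of_eq (congrArg _ ?_)
    module

/-- A kernel element would satisfy `(d+1) g = -g'`, but differentiation lowers the degree. -/
theorem shiftDeriv_injective [CharZero K] (d : ℕ) :
    Function.Injective (shiftDeriv K (d + 1)) := by
  rw [injective_iff_map_eq_zero]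
  intro g hg
  by_contra hne
  have hd : ((d + 1 : ℕ) : K) ≠ 0 := by exact_mod_cast Nat.succ_ne_zero d
  have h1 : ((d + 1 : ℕ) : K) • g = - derivative g := by
    rw [eq_neg_iff_add_eq_zero]; simpa [shiftDeriv] using hg
  have h2 := Polynomial.degree_derivative_lt hne
  rw [← Polynomial.degree_neg, ← h1, Polynomial.degree_smul_of_smul_regular] at h2
  · exact lt_irrefl _ h2
  · exact (IsSMulRegular.of_ne_zero hd)

theorem eq_zero_of_mem_solutionSpace [CharZero K] {f : K[X]⟦X⟧} (hf : f ∈ solutionSpace K)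
    (h0 : PowerSeries.coeff 0 f = 0) : f = 0 := by
  rw [mem_solutionSpace_iff] at hf
  ext1 d
  rw [map_zero]
  induction d with
  | zero => exact h0
  | succ d ih =>
    have := hf.2 d
    rw [ih, map_zero, smul_zero, Module.End.pow_apply] at this
    refine ((shiftDeriv_injective d).iterate 4) ?_
    rw [this, ← Module.End.pow_apply, map_zero]

theorem coeff_ISeries (h : K) (d : ℕ) :
    PowerSeries.coeff d (ISeries h) = expLog h * Polynomial.C (hyperCoeff h d) := by
  simp [ISeries]

/-- This turns the differential operator into multiplication in `K[P]/(P^4)`: `∂` brings down `P/h`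
from the exponential, and `d` equals `dh/h`. -/
theorem shiftDeriv_polyMap [CharZero K] {h : K} (hh : h ≠ 0) (f : QuinticAlg K →ₗ[K] K)
    (d : ℕ) (y : QuinticAlg K) :
    shiftDeriv K d (polyMap f (expLog h * Polynomial.C y)) = polyMap f (expLog h *
      Polynomial.C (h⁻¹ • (clsP K + algebraMap K (QuinticAlg K) (d * h)) * y)) := by
  have h1 : h⁻¹ • (clsP K + algebraMap K (QuinticAlg K) (d * h)) * y =
      (d : K) • y + h⁻¹ • clsP K * y := by
    have : (d : K) • y = h⁻¹ • ((algebraMap K (QuinticAlg K) (d * h)) * y) := by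
      rw [← Algebra.smul_def, smul_smul]; congr 1; field_simp
    rw [this, smul_add, add_mul, smul_mul_assoc, smul_mul_assoc, add_comm]
  rw [h1]
  simp only [shiftDeriv, LinearMap.add_apply, LinearMap.smul_apply, Module.End.one_apply]
  rw [derivative_polyMap, ← polyMap_smul, ← polyMap_add]
  congr 1
  rw [Polynomial.derivative_mul, derivative_expLog, Polynomial.derivative_C, mul_zero, add_zero,
    Polynomial.C_add, Polynomial.C_mul, mul_add, ← Polynomial.smul_C (d : K), mul_smul_comm]
  ring

theorem five_shiftDeriv_add_polyMap [CharZero K] {h : K} (hh : h ≠ 0)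
    (f : QuinticAlg K →ₗ[K] K) (d c : ℕ) (y : QuinticAlg K) :
    5 • shiftDeriv K d (polyMap f (expLog h * Polynomial.C y)) +
      c • polyMap f (expLog h * Polynomial.C y) = polyMap f (expLog h *
      Polynomial.C
        (h⁻¹ • (5 * clsP K + algebraMap K (QuinticAlg K) ((5 * d + c : ℕ) * h)) * y)) := by
  rw [shiftDeriv_polyMap hh, ← Nat.cast_smul_eq_nsmul K, ← Nat.cast_smul_eq_nsmul K,
    ← polyMap_smul, ← polyMap_smul, ← polyMap_add]
  congr 1
  rw [← mul_smul_comm, ← mul_smul_comm, ← mul_add, Polynomial.smul_C, Polynomial.smul_C,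
    ← Polynomial.C_add]
  congr 2
  have h1 : (c : K) • y = h⁻¹ • (algebraMap K (QuinticAlg K) (c * h) * y) := by
    rw [← Algebra.smul_def, smul_smul]; congr 1; field_simp
  rw [h1, smul_mul_assoc, smul_mul_assoc, smul_comm, ← smul_add]
  congr 1
  rw [Algebra.smul_def]
  simp only [map_mul, map_natCast]
  push_cast
  ring

theorem IComponent_mem_solutionSpace [CharZero K] {h : K} (hh : h ≠ 0) (j : Fin 4) :
    IComponent h j ∈ solutionSpace K := by
  rw [mem_solutionSpace_iff]
  simp only [IComponent, PowerSeries.coeff_mk, coeff_ISeries]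
  constructor
  · have h1 := shiftDeriv_polyMap hh (comp (K := K) j) 0
    have h2 : shiftDeriv K 0 = Polynomial.derivative := by simp [shiftDeriv]
    rw [h2] at h1
    simp only [Function.iterate_succ_apply', Function.iterate_zero_apply, h1]
    -- At `d = 0` each application multiplies by `P/h`, so four of them give `P^4 = 0`.
    have : h⁻¹ • (clsP K + (algebraMap K (QuinticAlg K)) ((0 : ℕ) * h)) *
      (h⁻¹ • (clsP K + (algebraMap K (QuinticAlg K)) ((0 : ℕ) * h)) *
      (h⁻¹ • (clsP K + (algebraMap K (QuinticAlg K)) ((0 : ℕ) * h)) *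
      (h⁻¹ • (clsP K + (algebraMap K (QuinticAlg K)) ((0 : ℕ) * h)) * hyperCoeff h 0))) = 0 := by
      simp only [Nat.cast_zero, zero_mul, map_zero, add_zero, Algebra.smul_def]
      linear_combination (algebraMap K (QuinticAlg K) h⁻¹) ^ 4 * hyperCoeff h 0 *
        clsP_pow_four (K := K)
    rw [this]
    rw [map_zero, mul_zero]
    exact (polyMapₗ (comp (K := K) j)).map_zero
  · intro d
    rw [Module.End.pow_apply]
    simp only [Function.iterate_succ_apply', Function.iterate_zero_apply, shiftDeriv_polyMap hh]
    have e1 := five_shiftDeriv_add_polyMap hh (comp (K := K) j) d 1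
    have e2 := five_shiftDeriv_add_polyMap hh (comp (K := K) j) d 2
    have e3 := five_shiftDeriv_add_polyMap hh (comp (K := K) j) d 3
    have e4 := five_shiftDeriv_add_polyMap hh (comp (K := K) j) d 4
    simp only [one_smul] at e1
    simp only [picardFuchsRight, Module.End.mul_apply, LinearMap.add_apply, Module.End.ofNat_apply,
      Module.End.one_apply, e4, e3, e2, e1]
    rw [← Nat.cast_smul_eq_nsmul K, ← polyMap_smul, ← mul_smul_comm, Polynomial.smul_C]
    congr 3
    simp only [Algebra.smul_def]
    have h1 : algebraMap K (QuinticAlg K) ((5 : ℕ) : K) = 5 := (map_natCast _ 5).trans Nat.cast_ofNat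
    rw [h1]
    linear_combination (algebraMap K (QuinticAlg K) h⁻¹) ^ 4 * hyperCoeff_succ hh d

theorem coeff_zero_IComponent (h : K) (j : Fin 4) :
    PowerSeries.coeff 0 (IComponent h j) =
      Polynomial.monomial (j : ℕ) (((j : ℕ).factorial : K)⁻¹ * h⁻¹ ^ (j : ℕ)) := by
  ext n
  rw [IComponent, PowerSeries.coeff_mk, coeff_polyMap, coeff_ISeries, hyperCoeff_zero, map_one,
    mul_one, expLog_coeff, comp_algebraMap_mul_clsP_pow j.2, Polynomial.coeff_monomial]
  split_ifs with h1
  · rw [h1]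
  · rfl

theorem linearIndependent_IComponent [CharZero K] {h : K} (hh : h ≠ 0) :
    LinearIndependent K (IComponent h) := by
  rw [Fintype.linearIndependent_iff]
  intro g hg i
  have := congrArg (fun f => (PowerSeries.coeff 0 f).coeff (i : ℕ)) hg
  simp only [map_sum, PowerSeries.coeff_smul, coeff_zero_IComponent, map_zero,
    Polynomial.finsetSum_coeff, Polynomial.coeff_smul, Polynomial.coeff_monomial,
    Polynomial.coeff_zero, Fin.val_inj, smul_ite, smul_zero] at this
  rw [Finset.sum_ite_eq' Finset.univ i, if_pos (Finset.mem_univ _), smul_eq_mul] at this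
  refine (mul_eq_zero.mp this).resolve_right ?_
  have := Nat.factorial_ne_zero (i : ℕ)
  positivity

theorem span_IComponent [CharZero K] {h : K} (hh : h ≠ 0) :
    Submodule.span K (Set.range (IComponent h)) = solutionSpace K := by
  apply le_antisymm
  · rw [Submodule.span_le]
    rintro _ ⟨j, rfl⟩
    exact IComponent_mem_solutionSpace hh j
  · intro f hf
    set f₀ := PowerSeries.coeff 0 f
    -- The second factor inverts the coefficient of `ℓ ^ j` in the leading term of the `j`-th
    -- component.
    let c : Fin 4 → K := fun j => f₀.coeff j * ((j : ℕ).factorial * h ^ (j : ℕ))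
    have hmem : ∑ j, c j • IComponent h j ∈ Submodule.span K (Set.range (IComponent h)) :=
      Submodule.sum_mem _ fun j _ => Submodule.smul_mem _ _ (Submodule.subset_span ⟨j, rfl⟩)
    have hmem' : ∑ j, c j • IComponent h j ∈ solutionSpace K :=
      Submodule.sum_mem _ fun j _ => Submodule.smul_mem _ _ (IComponent_mem_solutionSpace hh j)
    have key : f - ∑ j, c j • IComponent h j = 0 := by
      apply eq_zero_of_mem_solutionSpace (Submodule.sub_mem _ hf hmem')
      rw [map_sub, sub_eq_zero, map_sum]
      simp only [PowerSeries.coeff_smul, coeff_zero_IComponent]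
      -- In degree at least four, the fourth derivative would multiply the leading coefficient by a
      -- nonzero falling factorial.
      have hdeg : f₀.natDegree < 4 := by
        by_contra hcon
        have h4 := ((mem_solutionSpace_iff f).mp hf).1
        have := congrArg (fun g => g.coeff (f₀.natDegree - 4)) h4
        simp only [Polynomial.coeff_iterate_derivative, Polynomial.coeff_zero] at this
        rw [Nat.sub_add_cancel (by omega), smul_eq_zero] at this
        rcases this with h5 | h5
        · have := Nat.descFactorial_pos.mpr (show 4 ≤ f₀.natDegree by omega)
          omega
        · have h6 : f₀ = 0 := Polynomial.leadingCoeff_eq_zero.mp h5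
          rw [h6] at hcon
          simp at hcon
      change f₀ = _
      conv_lhs => rw [Polynomial.as_sum_range' f₀ 4 hdeg, Finset.sum_range]
      refine Finset.sum_congr rfl fun j _ => ?_
      rw [Polynomial.smul_monomial]
      congr 1
      simp only [c, smul_eq_mul]
      have := Nat.factorial_ne_zero (j : ℕ)
      rw [inv_pow]
      field_simp
    rw [sub_eq_zero.mp key]
    exact hmem

end DifferentialEquation

/-! ### Dirichlet integrals -/

open Filter Topology Set in
/-- A Beta integral in the form in which it arises from polar coordinates. -/
theorem integral_Ioi_pow_div (A : ℝ) (hA : 0 < A) (a c : ℕ) :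
    IntegrableOn (fun y : ℝ => y ^ (2 * a + 1) / (A + y ^ 2) ^ (c + a + 2)) (Ioi 0) ∧
      ∫ y in Ioi (0 : ℝ), y ^ (2 * a + 1) / (A + y ^ 2) ^ (c + a + 2) =
        a.factorial * c.factorial / (2 * (c + a + 1).factorial) / A ^ (c + 1) := by
  have hpos : ∀ y : ℝ, 0 < A + y ^ 2 := fun y => by positivity
  have hlim : ∀ n, Tendsto (fun y : ℝ => ((A + y ^ 2) ^ (n + 1))⁻¹) atTop (𝓝 0) := fun n => by
    apply Tendsto.inv_tendsto_atTop
    apply (tendsto_pow_atTop (Nat.succ_ne_zero n)).comp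
    exact tendsto_atTop_add_const_left _ _ (tendsto_pow_atTop two_ne_zero)
  have hder : ∀ (n : ℕ) (y : ℝ), HasDerivAt (fun y : ℝ => ((A + y ^ 2) ^ (n + 1))⁻¹)
      (-(2 * (n + 1) * y / (A + y ^ 2) ^ (n + 2))) y := fun n y => by
    have h1 : HasDerivAt (fun y : ℝ => A + y ^ 2) (2 * y) y := by
      simpa using (hasDerivAt_pow 2 y).const_add A
    have h2 := (h1.pow (n + 1)).inv (pow_ne_zero _ (hpos y).ne')
    refine h2.congr_deriv ?_
    have := (hpos y).ne'
    simp only [Pi.pow_apply, Nat.add_sub_cancel]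
    push_cast
    field_simp
    ring
  induction a with
  | zero =>
    have hd : ∀ y ∈ Ici (0 : ℝ), HasDerivAt
        (fun y : ℝ => -(2 * (c + 1) : ℝ)⁻¹ * ((A + y ^ 2) ^ (c + 1))⁻¹)
        (y ^ (2 * 0 + 1) / (A + y ^ 2) ^ (c + 0 + 2)) y := fun y _ => by
      refine ((hder c y).const_mul _).congr_deriv ?_
      have := (hpos y).ne'
      have : (c : ℝ) + 1 ≠ 0 := by positivity
      simp only [mul_zero, zero_add, add_zero, pow_one]
      field_simp
    have hl := (hlim c).const_mul (-(2 * (c + 1) : ℝ)⁻¹)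
    have hp : ∀ y ∈ Ioi (0 : ℝ), 0 ≤ y ^ (2 * 0 + 1) / (A + y ^ 2) ^ (c + 0 + 2) := fun y hy => by
      have := hpos y
      have : 0 < y := hy
      positivity
    have hint := integrableOn_Ioi_deriv_of_nonneg' hd hp hl
    refine ⟨hint, ?_⟩
    rw [integral_Ioi_of_hasDerivAt_of_tendsto' hd hint hl]
    have : (c : ℝ) + 1 ≠ 0 := by positivity
    have := Nat.factorial_ne_zero c
    simp only [Nat.factorial_zero, Nat.factorial_succ, add_zero]
    push_cast
    field_simp
    ring
  | succ a ih =>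
    obtain ⟨ih1, ih2⟩ := ih
    -- Dominated by the integrand of the previous case, since `y² ≤ A + y²`.
    have hint : IntegrableOn
        (fun y : ℝ => y ^ (2 * (a + 1) + 1) / (A + y ^ 2) ^ (c + (a + 1) + 2)) (Ioi 0) := by
      refine ih1.mono' ?_ ?_
      · refine (Continuous.aestronglyMeasurable ?_)
        exact (continuous_id.pow _).div (by fun_prop) fun y => pow_ne_zero _ (hpos y).ne'
      · refine (ae_restrict_mem measurableSet_Ioi).mono fun y hy => ?_
        have hy : 0 < y := hy
        have h1 := hpos y
        rw [Real.norm_of_nonneg (by positivity), div_le_div_iff₀ (by positivity) (by positivity)]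
        have : y ^ (2 * (a + 1) + 1) * (A + y ^ 2) ^ (c + a + 2) =
            y ^ (2 * a + 1) * (A + y ^ 2) ^ (c + a + 2) * y ^ 2 := by ring
        rw [this]
        have : y ^ (2 * a + 1) * (A + y ^ 2) ^ (c + (a + 1) + 2) =
            y ^ (2 * a + 1) * (A + y ^ 2) ^ (c + a + 2) * (A + y ^ 2) := by ring
        rw [this]
        gcongr
        linarith
    refine ⟨hint, ?_⟩
    -- Integration by parts: this primitive vanishes at both ends, so the new integral is
    -- `(a+1)/(c+a+2)` times the previous one.
    have hd : ∀ y ∈ Ici (0 : ℝ), HasDerivAt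
        (fun y : ℝ => y ^ (2 * (a + 1)) * ((A + y ^ 2) ^ (c + a + 1 + 1))⁻¹)
        (2 * (a + 1) * (y ^ (2 * a + 1) / (A + y ^ 2) ^ (c + a + 2)) -
          2 * (c + a + 2) * (y ^ (2 * (a + 1) + 1) / (A + y ^ 2) ^ (c + (a + 1) + 2))) y :=
      fun y _ => by
        refine ((hasDerivAt_pow (2 * (a + 1)) y).mul (hder (c + a + 1) y)).congr_deriv ?_
        have := (hpos y).ne'
        have e : 2 * (a + 1) - 1 = 2 * a + 1 := by omega
        rw [e]
        push_cast
        rw [show c + (a + 1) + 2 = c + a + 1 + 2 by ring]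
        field_simp
        ring
    have hl : Tendsto (fun y : ℝ => y ^ (2 * (a + 1)) * ((A + y ^ 2) ^ (c + a + 1 + 1))⁻¹) atTop
        (𝓝 0) := by
      refine squeeze_zero (fun y => ?_) (fun y => ?_) (hlim c)
      · have := hpos y
        rw [pow_mul]; positivity
      · have := hpos y
        rw [show c + a + 1 + 1 = (a + 1) + (c + 1) by ring, pow_add, mul_inv, ← mul_assoc,
          pow_mul]
        have h2 : (y ^ 2) ^ (a + 1) * ((A + y ^ 2) ^ (a + 1))⁻¹ ≤ 1 := by
          rw [← div_eq_mul_inv, div_le_one (by positivity)]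
          gcongr
          linarith
        exact mul_le_of_le_one_left (by positivity) h2
    have hi := integral_Ioi_of_hasDerivAt_of_tendsto' hd
      ((ih1.const_mul _).sub (hint.const_mul _)) hl
    rw [integral_sub (ih1.const_mul _) (hint.const_mul _), integral_const_mul,
      integral_const_mul, ih2] at hi
    have h3 : ((c + a + 2 : ℕ) : ℝ) ≠ 0 := by positivity
    push_cast at h3
    have h4 : ∫ y in Ioi (0 : ℝ), y ^ (2 * (a + 1) + 1) / (A + y ^ 2) ^ (c + (a + 1) + 2) =
        (a + 1) / (c + a + 2) * (a.factorial * c.factorial / (2 * (c + a + 1).factorial) /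
          A ^ (c + 1)) := by
      rw [zero_pow (by omega : 2 * (a + 1) ≠ 0), zero_mul, sub_zero] at hi
      field_simp at hi ⊢
      linarith
    rw [h4, show c + (a + 1) + 1 = (c + a + 1) + 1 by ring, Nat.factorial_succ (c + a + 1),
      Nat.factorial_succ a]
    push_cast
    have := Nat.factorial_ne_zero (c + a + 1)
    have h5 : (c : ℝ) + a + 1 + 1 ≠ 0 := by convert h3 using 1; ring
    field_simp
    ring

theorem integrable_normSq_pow_div (A : ℝ) (hA : 0 < A) (a c : ℕ) :
    Integrable (fun u : ℂ => Complex.normSq u ^ a / (A + Complex.normSq u) ^ (c + a + 2)) := by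
  simp only [Complex.normSq_eq_norm_sq]
  rw [integrable_fun_norm_addHaar (E := ℂ) volume
    (f := fun y => (y ^ 2) ^ a / (A + y ^ 2) ^ (c + a + 2))]
  refine (integral_Ioi_pow_div A hA a c).1.congr_fun (fun y _ => ?_) measurableSet_Ioi
  simp only [Complex.finrank_real_complex, smul_eq_mul]
  ring

theorem integral_normSq_pow_div (A : ℝ) (hA : 0 < A) (a c : ℕ) :
    ∫ u : ℂ, Complex.normSq u ^ a / (A + Complex.normSq u) ^ (c + a + 2) =
      Real.pi * (a.factorial * c.factorial / (c + a + 1).factorial) / A ^ (c + 1) := by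
  simp only [Complex.normSq_eq_norm_sq]
  rw [integral_fun_norm_addHaar (E := ℂ) volume
    (fun y => (y ^ 2) ^ a / (A + y ^ 2) ^ (c + a + 2))]
  have h1 : ∫ y in Set.Ioi (0 : ℝ), y ^ (Module.finrank ℝ ℂ - 1) •
      ((y ^ 2) ^ a / (A + y ^ 2) ^ (c + a + 2)) =
      ∫ y in Set.Ioi (0 : ℝ), y ^ (2 * a + 1) / (A + y ^ 2) ^ (c + a + 2) := by
    congr 1
    ext y
    simp only [Complex.finrank_real_complex, smul_eq_mul]
    ring
  rw [h1, (integral_Ioi_pow_div A hA a c).2]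
  have h2 : (volume : Measure ℂ).real (Metric.ball 0 1) = Real.pi := by
    simp [Measure.real, Complex.volume_ball]
  rw [h2, Complex.finrank_real_complex]
  simp only [nsmul_eq_mul, smul_eq_mul]
  push_cast
  field_simp

/-- Induction on `N`: the inner integral over the last variables is the same statement with `A`
replaced by `A + |u₀|²` and `c` by `c + a₀ + 1`, and the outer one is the one-variable integral.
This is why `A` and `c` are left free. Lower integrals allow Tonelli before integrability is known;
integrability is then read off from finiteness. -/
theorem lintegral_prod_normSq_pow_div {N : ℕ} (a : Fin N → ℕ) (c : ℕ) (A : ℝ) (hA : 0 < A) :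
    ∫⁻ u : Fin N → ℂ, ENNReal.ofReal ((∏ j, Complex.normSq (u j) ^ a j) /
        (A + ∑ j, Complex.normSq (u j)) ^ (c + ∑ j, a j + N + 1)) =
      ENNReal.ofReal (Real.pi ^ N * ((∏ j, ((a j).factorial : ℝ)) * c.factorial /
        (c + ∑ j, a j + N).factorial) / A ^ (c + 1)) := by
  induction N generalizing c A with
  | zero =>
    simp only [Finset.univ_eq_empty, Finset.prod_empty, Finset.sum_empty, add_zero, lintegral_const,
      pow_zero, one_mul]
    have := Nat.factorial_ne_zero c
    rw [volume_pi, Measure.pi_univ]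
    simp
    field_simp
  | succ N ih =>
    have hm : Measurable fun u : Fin (N + 1) → ℂ =>
        ENNReal.ofReal ((∏ j, Complex.normSq (u j) ^ a j) /
        (A + ∑ j, Complex.normSq (u j)) ^ (c + ∑ j, a j + (N + 1) + 1)) := by
      have : Measurable Complex.normSq := Complex.continuous_normSq.measurable
      fun_prop
    have e := (volume_preserving_piFinSuccAbove (fun _ : Fin (N + 1) => ℂ) 0).symm
    rw [← e.lintegral_comp hm]
    simp only [MeasurableEquiv.piFinSuccAbove_symm_apply, Fin.insertNthEquiv, Equiv.coe_fn_mk,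
      Fin.prod_univ_succ, Fin.sum_univ_succ, Fin.insertNth_zero', Fin.cons_zero, Fin.cons_succ]
    have hnn : ∀ z : ℂ, 0 ≤ Complex.normSq z := Complex.normSq_nonneg
    rw [Measure.volume_eq_prod, lintegral_prod _ (by
      have : Measurable Complex.normSq := Complex.continuous_normSq.measurable
      fun_prop)]
    have step : ∀ x : ℂ, ∫⁻ y : Fin N → ℂ, ENNReal.ofReal
        ((Complex.normSq x ^ a 0 * ∏ j, Complex.normSq (y j) ^ a j.succ) /
        (A + (Complex.normSq x + ∑ j, Complex.normSq (y j))) ^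
          (c + (a 0 + ∑ j : Fin N, a j.succ) + (N + 1) + 1)) =
        ENNReal.ofReal (Real.pi ^ N * ((∏ j : Fin N, ((a j.succ).factorial : ℝ)) *
          (c + a 0 + 1).factorial / (c + a 0 + 1 + ∑ j : Fin N, a j.succ + N).factorial) *
          (Complex.normSq x ^ a 0 / (A + Complex.normSq x) ^ (c + a 0 + 2))) := fun x => by
      have h1 := ih (fun j => a j.succ) (c + a 0 + 1) (A + Complex.normSq x)
        (by have := hnn x; positivity)
      have h2 : ∀ y : Fin N → ℂ, ENNReal.ofReal
        ((Complex.normSq x ^ a 0 * ∏ j, Complex.normSq (y j) ^ a j.succ) /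
        (A + (Complex.normSq x + ∑ j, Complex.normSq (y j))) ^
          (c + (a 0 + ∑ j : Fin N, a j.succ) + (N + 1) + 1)) =
          ENNReal.ofReal (Complex.normSq x ^ a 0) *
          ENNReal.ofReal ((∏ j, Complex.normSq (y j) ^ a j.succ) /
        (A + Complex.normSq x + ∑ j, Complex.normSq (y j)) ^
          (c + a 0 + 1 + ∑ j : Fin N, a j.succ + N + 1)) := fun y => by
        rw [← ENNReal.ofReal_mul (pow_nonneg (hnn x) _), mul_div_assoc, ← add_assoc A]
        congr 4
        ring
      simp only [h2]
      rw [lintegral_const_mul' _ _ ENNReal.ofReal_ne_top, h1,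
        ← ENNReal.ofReal_mul (pow_nonneg (hnn x) _)]
      congr 1
      ring
    simp only [step]
    rw [← ofReal_integral_eq_lintegral_ofReal
      ((integrable_normSq_pow_div A hA (a 0) c).const_mul _)
      (Filter.Eventually.of_forall fun x => by have := hnn x; positivity),
      integral_const_mul, integral_normSq_pow_div A hA]
    congr 1
    have := Nat.factorial_ne_zero (c + a 0 + 1)
    rw [show c + (a 0 + ∑ j : Fin N, a j.succ) + (N + 1) =
      c + a 0 + 1 + ∑ j : Fin N, a j.succ + N by ring]
    field_simp
    ring

theorem integrable_prod_normSq_pow_div {N : ℕ} (a : Fin N → ℕ) (c : ℕ) :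
    Integrable fun u : Fin N → ℂ => (∏ j, Complex.normSq (u j) ^ a j) /
        (1 + ∑ j, Complex.normSq (u j)) ^ (c + ∑ j, a j + N + 1) := by
  have hnn : ∀ z : ℂ, 0 ≤ Complex.normSq z := Complex.normSq_nonneg
  refine ⟨Measurable.aestronglyMeasurable ?_, ?_⟩
  · have : Measurable Complex.normSq := Complex.continuous_normSq.measurable
    fun_prop
  · rw [hasFiniteIntegral_iff_ofReal (Filter.Eventually.of_forall fun u => ?_),
      lintegral_prod_normSq_pow_div a c 1 one_pos]
    · exact ENNReal.ofReal_lt_top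
    · exact div_nonneg (Finset.prod_nonneg fun j _ => pow_nonneg (hnn _) _)
        (pow_nonneg (add_nonneg zero_le_one (Finset.sum_nonneg fun j _ => hnn _)) _)

theorem integral_prod_normSq_pow_div {N : ℕ} (a : Fin N → ℕ) (c : ℕ) :
    ∫ u : Fin N → ℂ, (∏ j, Complex.normSq (u j) ^ a j) /
        (1 + ∑ j, Complex.normSq (u j)) ^ (c + ∑ j, a j + N + 1) =
      Real.pi ^ N * ((∏ j, ((a j).factorial : ℝ)) * c.factorial /
        (c + ∑ j, a j + N).factorial) := by
  have hnn : ∀ z : ℂ, 0 ≤ Complex.normSq z := Complex.normSq_nonneg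
  rw [integral_eq_lintegral_of_nonneg_ae (Filter.Eventually.of_forall fun u => ?_)
    (integrable_prod_normSq_pow_div a c).1, lintegral_prod_normSq_pow_div a c 1 one_pos,
    ENNReal.toReal_ofReal (by positivity), one_pow, div_one]
  exact div_nonneg (Finset.prod_nonneg fun j _ => pow_nonneg (hnn _) _)
    (pow_nonneg (add_nonneg zero_le_one (Finset.sum_nonneg fun j _ => hnn _)) _)

/-! ### Powers of sums of square-zero elements -/

theorem add_pow_of_sq_eq_zero {R : Type*} [CommRing R] {a : R} (ha : a ^ 2 = 0) (b : R) (n : ℕ) :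
    (a + b) ^ (n + 1) = b ^ (n + 1) + (n + 1) * a * b ^ n := by
  induction n with
  | zero => simp; ring
  | succ n ih =>
    rw [pow_succ, ih]
    push_cast
    linear_combination ((n : R) + 1) * b ^ n * ha

/-- Only squarefree monomials survive. The two claims are proved together because the first for
`insert i S` uses the second for `S`. -/
theorem sum_pow_card {R ι : Type*} [CommRing R] [DecidableEq ι] (t : ι → R)
    (ht : ∀ j, t j ^ 2 = 0) (S : Finset ι) :
    (∑ j ∈ S, t j) ^ S.card = S.card.factorial * ∏ j ∈ S, t j ∧
      (∑ j ∈ S, t j) ^ (S.card + 1) = 0 := by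
  induction S using Finset.induction_on with
  | empty => simp
  | insert i S hi ih =>
    rw [Finset.sum_insert hi, Finset.prod_insert hi, Finset.card_insert_of_notMem hi,
      add_pow_of_sq_eq_zero (ht i), add_pow_of_sq_eq_zero (ht i), ih.2, ih.1,
      pow_succ _ (S.card + 1), ih.2, Nat.factorial_succ]
    push_cast
    constructor <;> ring

theorem sum_pow_card_sub_one {R ι : Type*} [CommRing R] [DecidableEq ι] (t : ι → R)
    (ht : ∀ j, t j ^ 2 = 0) (S : Finset ι) (hS : S.Nonempty) :
    (∑ j ∈ S, t j) ^ (S.card - 1) =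
      (S.card - 1).factorial * ∑ j ∈ S, ∏ k ∈ S.erase j, t k := by
  induction hS using Finset.Nonempty.cons_induction with
  | singleton i => simp
  | cons i S hi hS ih =>
    obtain ⟨n, hn⟩ : ∃ n, S.card = n + 1 := ⟨S.card - 1, by have := hS.card_pos; omega⟩
    have h1 := (sum_pow_card t ht S).1
    rw [Finset.cons_eq_insert, Finset.sum_insert hi, Finset.sum_insert hi,
      Finset.card_insert_of_notMem hi, Finset.erase_insert hi]
    rw [hn] at h1 ih ⊢
    simp only [Nat.add_sub_cancel] at ih ⊢
    rw [add_pow_of_sq_eq_zero (ht i), h1, ih]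
    have h2 : ∑ j ∈ S, ∏ k ∈ (insert i S).erase j, t k =
        t i * ∑ j ∈ S, ∏ k ∈ S.erase j, t k := by
      rw [Finset.mul_sum]
      refine Finset.sum_congr rfl fun j hj => ?_
      have hij : i ≠ j := fun h => hi (h ▸ hj)
      rw [Finset.erase_insert_of_ne hij, Finset.prod_insert fun h => hi (Finset.mem_of_mem_erase h)]
    rw [h2, Nat.factorial_succ]
    push_cast
    ring

/-- A determinant lemma for a rank-one perturbation. As `T` squares to zero, the binomial expansion
stops after the linear term; with `r = 1 + ∑ c j`, the two terms combine through `1 - (r-1)/r =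
1/r`, which raises the exponent of `r` from `N` to `N + 1`. -/
theorem smul_sum_sub_pow {R : Type*} [CommRing R] [Algebra ℝ R] {N : ℕ} (t : Fin N → R) (T : R)
    (ht : ∀ j, t j ^ 2 = 0) (hT : T ^ 2 = 0) (c : Fin N → ℝ)
    (htT : ∀ j, (∏ k ∈ Finset.univ.erase j, t k) * T = c j • ∏ k, t k)
    (hr : 0 < 1 + ∑ j, c j) {b : ℝ} (hb : b ≠ 0) :
    (b⁻¹ • ((1 + ∑ j, c j)⁻¹ • ∑ j, t j - ((1 + ∑ j, c j) ^ 2)⁻¹ • T)) ^ N =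
      (N.factorial / b ^ N / (1 + ∑ j, c j) ^ (N + 1)) • ∏ j, t j := by
  set r := 1 + ∑ j, c j with hrdef
  rcases N with _ | n
  · simp [hrdef]
  · have e : r⁻¹ • ∑ j, t j - (r ^ 2)⁻¹ • T = r⁻¹ • ((-(r⁻¹ • T)) + ∑ j, t j) := by
      rw [smul_add, smul_neg, smul_smul, sq, mul_inv]; abel
    have hT' : (-(r⁻¹ • T)) ^ 2 = 0 := by rw [neg_sq, _root_.smul_pow, hT, smul_zero]
    have s1 := (sum_pow_card t ht Finset.univ).1
    have s2 := sum_pow_card_sub_one t ht Finset.univ Finset.univ_nonempty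
    rw [Finset.card_univ, Fintype.card_fin] at s1 s2
    rw [Nat.add_sub_cancel] at s2
    have s3 : T * ∑ j, ∏ k ∈ Finset.univ.erase j, t k = (r - 1) • ∏ k, t k := by
      rw [mul_comm, Finset.sum_mul, Finset.sum_congr rfl fun j _ => htT j,
        ← Finset.sum_smul, hrdef, add_sub_cancel_left]
    rw [e, smul_smul, _root_.smul_pow, add_pow_of_sq_eq_zero hT', s1, s2]
    have s4 : ((n : R) + 1) * -(r⁻¹ • T) * (n.factorial * ∑ j, ∏ k ∈ Finset.univ.erase j, t k) =
        ((n + 1 : ℝ) * n.factorial * -(r⁻¹ * (r - 1))) • ∏ k, t k := by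
      calc _ = (((n : R) + 1) * n.factorial) *
            -(r⁻¹ • (T * ∑ j, ∏ k ∈ Finset.univ.erase j, t k)) := by
            rw [← smul_mul_assoc]; ring
        _ = ((n + 1 : ℝ) * n.factorial) • -(r⁻¹ • (T * ∑ j, ∏ k ∈ Finset.univ.erase j, t k)) := by
            rw [Algebra.smul_def ((n + 1 : ℝ) * _)]; simp
        _ = _ := by rw [s3, smul_smul, ← neg_smul, smul_smul]
    have s5 : ((n + 1).factorial : R) * ∏ k, t k = ((n + 1).factorial : ℝ) • ∏ k, t k := by
      rw [Algebra.smul_def]; simp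
    rw [s4, s5, ← add_smul, smul_smul]
    congr 1
    rw [Nat.factorial_succ, mul_pow, inv_pow, inv_pow]
    push_cast
    field_simp
    ring

/-! ### Products of two covectors -/

/-- Passing a covector costs two signs. Working in the centre makes the identities for commutative
rings above applicable to 2-forms. -/
theorem ι_mul_ι_mem_center {M : Type*} [AddCommGroup M] [Module ℝ M] (a b : M) :
    ExteriorAlgebra.ι ℝ a * ExteriorAlgebra.ι ℝ b ∈
      Subalgebra.center ℝ (ExteriorAlgebra ℝ M) := by
  rw [Subalgebra.mem_center_iff]
  intro x
  induction x using ExteriorAlgebra.induction with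
  | algebraMap r => exact Algebra.commutes r _
  | ι m =>
    have h1 := ExteriorAlgebra.ι_add_mul_swap (R := ℝ) m a
    have h2 := ExteriorAlgebra.ι_add_mul_swap (R := ℝ) m b
    rw [← mul_assoc, eq_neg_of_add_eq_zero_left h1, neg_mul, mul_assoc,
      eq_neg_of_add_eq_zero_left h2, mul_neg, neg_neg, mul_assoc]
  | mul x y hx hy => rw [mul_assoc, hy, ← mul_assoc, hx, mul_assoc]
  | add x y hx hy => rw [add_mul, mul_add, hx, hy]

/-- The product of two covectors, as an element of the centre of the exterior algebra. -/
def wedge {M : Type*} [AddCommGroup M] [Module ℝ M] (a b : M) :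
    Subalgebra.center ℝ (ExteriorAlgebra ℝ M) :=
  ⟨ExteriorAlgebra.ι ℝ a * ExteriorAlgebra.ι ℝ b, ι_mul_ι_mem_center a b⟩

theorem wedge_sq {M : Type*} [AddCommGroup M] [Module ℝ M] (a b : M) : wedge a b ^ 2 = 0 := by
  apply Subtype.ext
  have h := ExteriorAlgebra.ι_add_mul_swap (R := ℝ) b a
  simp only [wedge, sq, MulMemClass.mk_mul_mk, ZeroMemClass.coe_zero]
  rw [mul_assoc, ← mul_assoc (ExteriorAlgebra.ι ℝ b), eq_neg_of_add_eq_zero_left h, neg_mul,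
    mul_neg, mul_assoc, ExteriorAlgebra.ι_sq_zero, mul_zero, mul_zero, neg_zero]

/-- Evaluation of a form on the standard basis. -/
def topForm (m : ℕ) : ExteriorAlgebra ℝ (Fin m → ℝ) →ₗ[ℝ] ℝ :=
  ExteriorAlgebra.liftAlternating (R := ℝ)
    (Pi.single m (Matrix.detRowAlternating (R := ℝ) (n := Fin m)))

theorem topForm_ιMulti_single (m : ℕ) :
    topForm m (ExteriorAlgebra.ιMulti ℝ m fun a => Pi.single a 1) = 1 := by
  rw [topForm, ExteriorAlgebra.liftAlternating_apply_ιMulti, Pi.single_eq_same]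
  have : (fun a : Fin m => Pi.single a (1 : ℝ)) = (1 : Matrix (Fin m) (Fin m) ℝ) := by
    ext i j
    simp [Matrix.one_apply, Pi.single_apply, eq_comm]
  rw [this]
  exact Matrix.det_one

/-- The values of a covector on a family of vectors. -/
def restrictCovector {N m : ℕ} (v : Fin m → HomCoord N) :
    (HomCoord N →L[ℝ] ℝ) →ₗ[ℝ] (Fin m → ℝ) :=
  LinearMap.pi fun j =>
    (ContinuousLinearMap.coeLM ℝ : (HomCoord N →L[ℝ] ℝ) →ₗ[ℝ] (HomCoord N →ₗ[ℝ] ℝ)).flip (v j)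

theorem restrictCovector_apply {N m : ℕ} (v : Fin m → HomCoord N) (φ : HomCoord N →L[ℝ] ℝ)
    (j : Fin m) : restrictCovector v φ j = φ (v j) := rfl

/-- Pull-back along the frame is an algebra homomorphism, so powers of the curvature can be computed
in the coordinates of the chart. -/
theorem evalForm_eq_topForm {N m : ℕ} (v : Fin m → HomCoord N) (α : Form N) :
    evalForm v α = topForm m (ExteriorAlgebra.map (restrictCovector v) α) := by
  have : evalForm v = (topForm m).comp (ExteriorAlgebra.map (restrictCovector v)).toLinearMap := by
    apply ExteriorAlgebra.lhom_ext
    intro n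
    ext w
    simp only [LinearMap.compAlternatingMap_apply, LinearMap.comp_apply, AlgHom.toLinearMap_apply,
      ExteriorAlgebra.map_apply_ιMulti, evalForm, topForm,
      ExteriorAlgebra.liftAlternating_apply_ιMulti]
    by_cases h : n = m
    · subst h
      simp only [Pi.single_eq_same]
      rfl
    · simp [Pi.single_eq_of_ne h]
  rw [this]
  rfl

theorem evalForm_eq_zero_of_mem {N m n : ℕ} (v : Fin m → HomCoord N) (h : n ≠ m) {α : Form N}
    (hα : α ∈ ⋀[ℝ]^n (HomCoord N →L[ℝ] ℝ)) : evalForm v α = 0 := by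
  rw [← ExteriorAlgebra.ιMulti_span_fixedDegree] at hα
  induction hα using Submodule.span_induction with
  | mem x hx =>
    obtain ⟨w, rfl⟩ := hx
    rw [evalForm, ExteriorAlgebra.liftAlternating_apply_ιMulti, Pi.single_eq_of_ne h]
    rfl
  | zero => exact map_zero _
  | add x y _ _ hx hy => rw [map_add, hx, hy, add_zero]
  | smul c x _ hx => rw [map_smul, hx, smul_zero]

/-! ### The curvature of the Hopf connection -/

/-- The 1-form `Im ⟨x, dx⟩`, depending linearly on `x`. -/
def imInner {N : ℕ} : HomCoord N →L[ℝ] (HomCoord N →L[ℝ] ℝ) :=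
  ∑ j, ((dRe j).smulRight (dIm j) - (dIm j).smulRight (dRe j))

/-- The 1-form `Re ⟨x, dx⟩`, depending linearly on `x`. -/
def reInner {N : ℕ} : HomCoord N →L[ℝ] (HomCoord N →L[ℝ] ℝ) :=
  ∑ j, ((dRe j).smulRight (dRe j) + (dIm j).smulRight (dIm j))

theorem imInner_apply {N : ℕ} (x : HomCoord N) :
    imInner x = ∑ j, ((x j).re • dIm j - (x j).im • dRe j) := by
  simp [imInner, dRe, dIm]

theorem reInner_apply {N : ℕ} (x : HomCoord N) :
    reInner x = ∑ j, ((x j).re • dRe j + (x j).im • dIm j) := by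
  simp [reInner, dRe, dIm]

theorem dRe_apply {N : ℕ} (j : Fin (N + 1)) (x : HomCoord N) : dRe j x = (x j).re := rfl

theorem dIm_apply {N : ℕ} (j : Fin (N + 1)) (x : HomCoord N) : dIm j x = (x j).im := rfl

theorem hasFDerivAt_sum_normSq {N : ℕ} (x : HomCoord N) :
    HasFDerivAt (fun x : HomCoord N => ∑ j, Complex.normSq (x j)) ((2 : ℝ) • reInner x) x := by
  have h : ∀ j, HasFDerivAt (fun x : HomCoord N => Complex.normSq (x j))
      ((2 : ℝ) • ((x j).re • dRe j + (x j).im • dIm j)) x := fun j => by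
    have h1 := ((dRe (N := N) j).hasFDerivAt (x := x)).mul ((dRe (N := N) j).hasFDerivAt (x := x))
    have h2 := ((dIm (N := N) j).hasFDerivAt (x := x)).mul ((dIm (N := N) j).hasFDerivAt (x := x))
    refine (h1.add h2).congr_fderiv ?_
    simp only [dRe_apply, dIm_apply]
    module
  refine (HasFDerivAt.fun_sum fun j _ => h j).congr_fderiv ?_
  rw [reInner_apply, Finset.smul_sum]

theorem fderiv_hopfConnection {N : ℕ} (x v : HomCoord N)
    (hx : ∑ j, Complex.normSq (x j) ≠ 0) :
    fderiv ℝ hopfConnection x v =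
      (2 * Real.pi * ∑ j, Complex.normSq (x j))⁻¹ • imInner v -
        ((Real.pi)⁻¹ * ((∑ j, Complex.normSq (x j)) ^ 2)⁻¹ * reInner x v) • imInner x := by
  have hpi := Real.pi_ne_zero
  have h1 : (hopfConnection : HomCoord N → _) =
      fun x => (2 * Real.pi * ∑ j, Complex.normSq (x j))⁻¹ • imInner x := by
    ext1 x
    rw [imInner_apply]; rfl
  have h2 : HasFDerivAt (fun x : HomCoord N => (2 * Real.pi * ∑ j, Complex.normSq (x j))⁻¹) _ x :=
    (hasDerivAt_inv (by positivity)).comp_hasFDerivAt x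
      ((hasFDerivAt_sum_normSq x).const_mul (2 * Real.pi))
  rw [h1, (h2.fun_smul (imInner (N := N)).hasFDerivAt).fderiv]
  ext w
  simp
  field_simp
  ring

theorem imInner_single {N : ℕ} (j : Fin (N + 1)) (c : ℂ) :
    imInner (Pi.single j c) = c.re • dIm j - c.im • dRe j := by
  rw [imInner_apply, Finset.sum_eq_single j]
  · simp
  · intro k _ hk
    simp [Pi.single_eq_of_ne hk]
  · simp

theorem reInner_apply_single {N : ℕ} (x : HomCoord N) (j : Fin (N + 1)) (c : ℂ) :
    reInner x (Pi.single j c) = (x j).re * c.re + (x j).im * c.im := by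
  rw [reInner_apply, _root_.sum_apply, Finset.sum_eq_single j]
  · simp [dRe_apply, dIm_apply]
  · intro k _ hk
    simp [dRe_apply, dIm_apply, Pi.single_eq_of_ne hk]
  · simp

/-- Quotient rule: `d Im⟨x, dx⟩ = 2 ∑ dRe ∧ dIm` and `d‖x‖² = 2 Re⟨x, dx⟩`, so both factors 2 cancel
that of `2π`. -/
theorem extD_hopfConnection {N : ℕ} (x : HomCoord N) (hx : ∑ j, Complex.normSq (x j) ≠ 0) :
    extD hopfConnection x =
      (Real.pi)⁻¹ • ((∑ j, Complex.normSq (x j))⁻¹ •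
          ∑ j, ExteriorAlgebra.ι ℝ (dRe j) * ExteriorAlgebra.ι ℝ (dIm j) -
        ((∑ j, Complex.normSq (x j)) ^ 2)⁻¹ •
          (ExteriorAlgebra.ι ℝ (reInner x) * ExteriorAlgebra.ι ℝ (imInner x))) := by
  have hpi := Real.pi_ne_zero
  set r := ∑ j, Complex.normSq (x j)
  have h : ∀ j : Fin (N + 1), ExteriorAlgebra.ι ℝ (dRe j) *
      ExteriorAlgebra.ι ℝ (fderiv ℝ hopfConnection x (Pi.single j 1)) +
      ExteriorAlgebra.ι ℝ (dIm j) *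
        ExteriorAlgebra.ι ℝ (fderiv ℝ hopfConnection x (Pi.single j Complex.I)) =
      (Real.pi)⁻¹ • (r⁻¹ • (ExteriorAlgebra.ι ℝ (dRe j) * ExteriorAlgebra.ι ℝ (dIm j)) -
        (r ^ 2)⁻¹ • (((x j).re • ExteriorAlgebra.ι ℝ (dRe j) +
          (x j).im • ExteriorAlgebra.ι ℝ (dIm j)) * ExteriorAlgebra.ι ℝ (imInner x))) := fun j => by
    have hs := eq_neg_of_add_eq_zero_left (ExteriorAlgebra.ι_add_mul_swap (R := ℝ)
      (dIm (N := N) j) (dRe j))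
    rw [fderiv_hopfConnection _ _ hx, fderiv_hopfConnection _ _ hx, imInner_single, imInner_single,
      reInner_apply_single, reInner_apply_single]
    simp only [Complex.one_re, Complex.one_im, Complex.I_re, Complex.I_im, map_sub, map_smul,
      mul_sub, mul_smul_comm, one_smul, zero_smul, sub_zero, zero_sub, mul_one, mul_zero, add_zero,
      zero_add, hs, smul_sub, map_neg, mul_neg, smul_neg, neg_neg, add_mul, smul_add,
      smul_mul_assoc, smul_smul]
    change _ • _ - _ + (_ • _ - _) = _
    have e : (2 * Real.pi * r)⁻¹ = 2⁻¹ * (Real.pi⁻¹ * r⁻¹) := by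
      rw [mul_inv, mul_inv]; ring
    rw [show (∑ j, Complex.normSq (x j)) = r from rfl, e]
    module
  simp only [extD, h]
  rw [← Finset.smul_sum, Finset.sum_sub_distrib, ← Finset.smul_sum, ← Finset.smul_sum,
    ← Finset.sum_mul]
  congr 4
  rw [reInner_apply, map_sum]
  simp only [map_add, map_smul]

theorem extD_mem {N : ℕ} (θ : HomCoord N → (HomCoord N →L[ℝ] ℝ)) (x : HomCoord N) :
    extD θ x ∈ ⋀[ℝ]^2 (HomCoord N →L[ℝ] ℝ) := by
  have h : ∀ a b : HomCoord N →L[ℝ] ℝ, ExteriorAlgebra.ι ℝ a * ExteriorAlgebra.ι ℝ b ∈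
      ⋀[ℝ]^2 (HomCoord N →L[ℝ] ℝ) := fun a b => by
    rw [ExteriorAlgebra.exteriorPower, sq]
    exact Submodule.mul_mem_mul ⟨a, rfl⟩ ⟨b, rfl⟩
  exact Submodule.sum_mem _ fun j _ => Submodule.add_mem _ (h _ _) (h _ _)

theorem evalForm_extD_pow_eq_zero {N m n : ℕ} (v : Fin m → HomCoord N) (h : 2 * n ≠ m)
    (θ : HomCoord N → (HomCoord N →L[ℝ] ℝ)) (x : HomCoord N) :
    evalForm v (extD θ x ^ n) = 0 := by
  apply evalForm_eq_zero_of_mem v h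
  rw [ExteriorAlgebra.exteriorPower, pow_mul]
  exact Submodule.pow_mem_pow _ (extD_mem θ x) n

/-! ### The Fubini–Study volume form -/

/-- The coordinate covectors of the affine chart, in the order of `chartFrame`. -/
def stdCovector (N : ℕ) (j : Fin N) (b : Fin 2) : Fin (N * 2) → ℝ :=
  Pi.single (finProdFinEquiv (j, b)) 1

/-- The sign is `+1` because `finProdFinEquiv` places `(j, 0)` and `(j, 1)` next to each other, at
positions `2j` and `2j + 1`. -/
theorem topForm_prod_wedge (N : ℕ) :
    topForm (N * 2) (∏ j, wedge (stdCovector N j 0) (stdCovector N j 1) :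
      Subalgebra.center ℝ (ExteriorAlgebra ℝ (Fin (N * 2) → ℝ))) = 1 := by
  rw [← topForm_ιMulti_single]
  congr 1
  rw [ExteriorAlgebra.ιMulti_apply, List.ofFn_mul, List.prod_flatten, ← List.prod_ofFn,
    ← Subalgebra.coe_val, map_list_prod, List.map_ofFn, List.map_ofFn]
  congr 2
  ext j
  have h0 : finProdFinEquiv (j, (0 : Fin 2)) = ⟨j * 2 + 0, by omega⟩ := by
    apply Fin.ext; simp [finProdFinEquiv]; ring
  have h1 : finProdFinEquiv (j, (1 : Fin 2)) = ⟨j * 2 + 1, by omega⟩ := by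
    apply Fin.ext; simp [finProdFinEquiv]; ring
  simp [wedge, stdCovector, h0, h1]

theorem restrictCovector_dRe_zero (N : ℕ) :
    restrictCovector (chartFrame N) (dRe 0) = 0 := by
  ext a
  simp [restrictCovector_apply, chartFrame, dRe_apply]

theorem restrictCovector_dIm_zero (N : ℕ) :
    restrictCovector (chartFrame N) (dIm 0) = 0 := by
  ext a
  simp [restrictCovector_apply, chartFrame, dIm_apply]

theorem restrictCovector_dRe_succ (N : ℕ) (j : Fin N) :
    restrictCovector (chartFrame N) (dRe j.succ) = stdCovector N j 0 := by
  ext a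
  obtain ⟨⟨k, b⟩, rfl⟩ := finProdFinEquiv.surjective a
  simp only [restrictCovector_apply, chartFrame, dRe_apply, stdCovector, Equiv.symm_apply_apply]
  rw [Pi.single_apply, Pi.single_apply]
  fin_cases b <;> simp [eq_comm, apply_ite Complex.re]

theorem restrictCovector_dIm_succ (N : ℕ) (j : Fin N) :
    restrictCovector (chartFrame N) (dIm j.succ) = stdCovector N j 1 := by
  ext a
  obtain ⟨⟨k, b⟩, rfl⟩ := finProdFinEquiv.surjective a
  simp only [restrictCovector_apply, chartFrame, dIm_apply, stdCovector, Equiv.symm_apply_apply]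
  rw [Pi.single_apply, Pi.single_apply]
  fin_cases b <;> simp [eq_comm, apply_ite Complex.im]

/-- The covector `∑ (x_j dx_j + y_j dy_j)` of the affine chart. -/
def radialCovector {N : ℕ} (u : Fin N → ℂ) : Fin (N * 2) → ℝ :=
  ∑ j, ((u j).re • stdCovector N j 0 + (u j).im • stdCovector N j 1)

/-- The covector `∑ (x_j dy_j - y_j dx_j)` of the affine chart. -/
def angularCovector {N : ℕ} (u : Fin N → ℂ) : Fin (N * 2) → ℝ :=
  ∑ j, ((u j).re • stdCovector N j 1 - (u j).im • stdCovector N j 0)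

theorem restrictCovector_reInner_chart {N : ℕ} (u : Fin N → ℂ) :
    restrictCovector (chartFrame N) (reInner (chart u)) = radialCovector u := by
  rw [reInner_apply, map_sum, Fin.sum_univ_succ]
  simp only [map_add, map_smul, restrictCovector_dRe_zero, restrictCovector_dIm_zero,
    restrictCovector_dRe_succ, restrictCovector_dIm_succ, chart, Fin.cons_succ, smul_zero, zero_add]
  rfl

theorem restrictCovector_imInner_chart {N : ℕ} (u : Fin N → ℂ) :
    restrictCovector (chartFrame N) (imInner (chart u)) = angularCovector u := by
  rw [imInner_apply, map_sum, Fin.sum_univ_succ]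
  simp only [map_sub, map_smul, restrictCovector_dRe_zero, restrictCovector_dIm_zero,
    restrictCovector_dRe_succ, restrictCovector_dIm_succ, chart, Fin.cons_succ, smul_zero, zero_add,
    sub_zero]
  rfl

theorem wedge_mul_ι_eq_zero {M : Type*} [AddCommGroup M] [Module ℝ M] (a b : M) :
    (wedge a b : ExteriorAlgebra ℝ M) * ExteriorAlgebra.ι ℝ a = 0 ∧
      (wedge a b : ExteriorAlgebra ℝ M) * ExteriorAlgebra.ι ℝ b = 0 := by
  have h := ExteriorAlgebra.ι_add_mul_swap (R := ℝ) b a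
  constructor
  · rw [wedge, mul_assoc, eq_neg_of_add_eq_zero_left h, mul_neg, ← mul_assoc,
      ExteriorAlgebra.ι_sq_zero, zero_mul, neg_zero]
  · rw [wedge, mul_assoc, ExteriorAlgebra.ι_sq_zero, mul_zero]

/-- The product over `k ≠ j` annihilates every covector of index other than `j`. What remains is `(x
dx + y dy) ∧ (x dy - y dx) = (x² + y²) dx ∧ dy` in the `j`-th plane. -/
theorem prod_erase_wedge_mul {N : ℕ} (u : Fin N → ℂ) (j : Fin N) :
    (∏ k ∈ Finset.univ.erase j, wedge (stdCovector N k 0) (stdCovector N k 1)) *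
        wedge (radialCovector u) (angularCovector u) =
      Complex.normSq (u j) • ∏ k, wedge (stdCovector N k 0) (stdCovector N k 1) := by
  set t := fun k => wedge (stdCovector N k 0) (stdCovector N k 1)
  set Q := ∏ k ∈ Finset.univ.erase j, t k
  have hQ : ∀ k ≠ j, ∀ b, (Q : ExteriorAlgebra ℝ (Fin (N * 2) → ℝ)) *
      ExteriorAlgebra.ι ℝ (stdCovector N k b) = 0 := fun k hk b => by
    have hkm : k ∈ Finset.univ.erase j := Finset.mem_erase.mpr ⟨hk, Finset.mem_univ _⟩
    have h1 : Q = (∏ i ∈ (Finset.univ.erase j).erase k, t i) * t k :=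
      (Finset.prod_erase_mul _ _ hkm).symm
    have h2 := wedge_mul_ι_eq_zero (stdCovector N k 0) (stdCovector N k 1)
    rw [h1, MulMemClass.coe_mul, mul_assoc]
    fin_cases b
    · exact (congrArg _ h2.1).trans (mul_zero _)
    · exact (congrArg _ h2.2).trans (mul_zero _)
  have hc : ∀ x, x * (Q : ExteriorAlgebra ℝ (Fin (N * 2) → ℝ)) = Q * x :=
    Subalgebra.mem_center_iff.mp Q.2
  have hr : (Q : ExteriorAlgebra ℝ (Fin (N * 2) → ℝ)) * ExteriorAlgebra.ι ℝ (radialCovector u) =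
      Q * ((u j).re • ExteriorAlgebra.ι ℝ (stdCovector N j 0) +
        (u j).im • ExteriorAlgebra.ι ℝ (stdCovector N j 1)) := by
    rw [radialCovector, map_sum, Finset.mul_sum, Finset.sum_eq_single j]
    · simp
    · intro k _ hk
      simp [mul_add, hQ k hk]
    · simp
  have ha : (Q : ExteriorAlgebra ℝ (Fin (N * 2) → ℝ)) * ExteriorAlgebra.ι ℝ (angularCovector u) =
      Q * ((u j).re • ExteriorAlgebra.ι ℝ (stdCovector N j 1) -
        (u j).im • ExteriorAlgebra.ι ℝ (stdCovector N j 0)) := by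
    rw [angularCovector, map_sum, Finset.mul_sum, Finset.sum_eq_single j]
    · simp
    · intro k _ hk
      simp [mul_sub, hQ k hk]
    · simp
  have hs := eq_neg_of_add_eq_zero_left (ExteriorAlgebra.ι_add_mul_swap (R := ℝ)
      (stdCovector N j 1) (stdCovector N j 0))
  rw [← Finset.prod_erase_mul _ _ (Finset.mem_univ j)]
  apply Subtype.ext
  change (Q : ExteriorAlgebra ℝ (Fin (N * 2) → ℝ)) * (ExteriorAlgebra.ι ℝ (radialCovector u) *
    ExteriorAlgebra.ι ℝ (angularCovector u)) = Complex.normSq (u j) •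
    ((Q : ExteriorAlgebra ℝ (Fin (N * 2) → ℝ)) * (ExteriorAlgebra.ι ℝ (stdCovector N j 0) *
      ExteriorAlgebra.ι ℝ (stdCovector N j 1)))
  rw [← mul_assoc, hr, ← hc, mul_assoc, ha, ← mul_assoc, hc, mul_assoc, ← mul_smul_comm]
  congr 1
  simp only [add_mul, mul_sub, smul_mul_assoc, mul_smul_comm, ExteriorAlgebra.ι_sq_zero, hs,
    Complex.normSq_apply, smul_zero, smul_neg]
  module

theorem sum_normSq_chart {N : ℕ} (u : Fin N → ℂ) :
    ∑ j, Complex.normSq (chart u j) = 1 + ∑ j, Complex.normSq (u j) := by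
  simp [Fin.sum_univ_succ, chart]

theorem sum_normSq_chart_pos {N : ℕ} (u : Fin N → ℂ) :
    0 < ∑ j, Complex.normSq (chart u j) := by
  rw [sum_normSq_chart]
  have : 0 ≤ ∑ j, Complex.normSq (u j) := Finset.sum_nonneg fun j _ => Complex.normSq_nonneg _
  linarith

/-- The top power of the curvature is the Fubini–Study volume form. -/
theorem evalForm_extD_hopfConnection_pow {N : ℕ} (u : Fin N → ℂ) :
    evalForm (chartFrame N) (extD hopfConnection (chart u) ^ N) =
      N.factorial / Real.pi ^ N / (1 + ∑ j, Complex.normSq (u j)) ^ (N + 1) := by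
  have hpi := Real.pi_ne_zero
  have hr := sum_normSq_chart_pos u
  rw [evalForm_eq_topForm, map_pow, extD_hopfConnection _ hr.ne', sum_normSq_chart]
  rw [sum_normSq_chart] at hr
  set r := 1 + ∑ j, Complex.normSq (u j) with hrdef
  set t := fun k => wedge (stdCovector N k 0) (stdCovector N k 1)
  set T := wedge (radialCovector u) (angularCovector u)
  have h1 : ExteriorAlgebra.map (restrictCovector (chartFrame N)) ((Real.pi)⁻¹ • (r⁻¹ •
      ∑ j, ExteriorAlgebra.ι ℝ (dRe j) * ExteriorAlgebra.ι ℝ (dIm j) -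
        (r ^ 2)⁻¹ • (ExteriorAlgebra.ι ℝ (reInner (chart u)) *
          ExteriorAlgebra.ι ℝ (imInner (chart u))))) =
      (((Real.pi)⁻¹ • (r⁻¹ • ∑ j, t j - (r ^ 2)⁻¹ • T) :
        Subalgebra.center ℝ (ExteriorAlgebra ℝ (Fin (N * 2) → ℝ))) :
          ExteriorAlgebra ℝ (Fin (N * 2) → ℝ)) := by
    -- The summand of index 0 drops out because that homogeneous coordinate is constant on the
    -- chart.
    rw [map_smul, map_sub, map_smul, map_smul, map_sum, Fin.sum_univ_succ]
    simp only [map_mul, ExteriorAlgebra.map_apply_ι, restrictCovector_dRe_zero,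
      restrictCovector_dRe_succ, restrictCovector_dIm_succ, restrictCovector_reInner_chart,
      restrictCovector_imInner_chart, map_zero, zero_mul, zero_add]
    simp [t, T, wedge]
  rw [h1]
  have h2 : ((Real.pi)⁻¹ • (r⁻¹ • ∑ j, t j - (r ^ 2)⁻¹ • T)) ^ N =
      (N.factorial / Real.pi ^ N / r ^ (N + 1)) • ∏ j, t j := by
    exact smul_sum_sub_pow t T (fun j => wedge_sq _ _) (wedge_sq _ _) _
      (fun j => prod_erase_wedge_mul u j) hr hpi
  rw [← SubmonoidClass.coe_pow, h2]
  have h3 := topForm_prod_wedge N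
  change topForm (N * 2) ((N.factorial / Real.pi ^ N / r ^ (N + 1)) •
    ((∏ j, t j : Subalgebra.center ℝ (ExteriorAlgebra ℝ (Fin (N * 2) → ℝ))) :
      ExteriorAlgebra ℝ (Fin (N * 2) → ℝ))) = _
  rw [map_smul, h3, smul_eq_mul, mul_one]

/-! ### Residues at infinity -/

section Residue

variable {R : Type*} [CommRing R]

/-- The generating series `∏ 1 / (1 - w t)` of the complete homogeneous symmetric functions. -/
def homSeries (s : Multiset R) : R⟦X⟧ := (s.map fun w => PowerSeries.mk (w ^ ·)).prod

/-- The coefficient of `p⁻¹` in the expansion at infinity of `F(p) / ∏ (p - w)`. -/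
def resInfty (s : Multiset R) : R[X] →ₗ[R] R :=
  Polynomial.lsum fun n => LinearMap.mulRight R
    (if s.card ≤ n + 1 then PowerSeries.coeff (n + 1 - s.card) (homSeries s) else 0)

theorem resInfty_monomial (s : Multiset R) (n : ℕ) (c : R) :
    resInfty s (Polynomial.monomial n c) =
      c * if s.card ≤ n + 1 then PowerSeries.coeff (n + 1 - s.card) (homSeries s) else 0 := by
  simp [resInfty, Polynomial.lsum_apply, Polynomial.sum_monomial_index]

theorem homSeries_cons (w : R) (s : Multiset R) :
    homSeries (w ::ₘ s) = PowerSeries.mk (w ^ ·) * homSeries s := by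
  simp [homSeries]

theorem homSeries_cons_sub (w : R) (s : Multiset R) :
    homSeries (w ::ₘ s) - PowerSeries.X * PowerSeries.C w * homSeries (w ::ₘ s) = homSeries s := by
  have h : (1 - PowerSeries.X * PowerSeries.C w) * PowerSeries.mk (w ^ ·) = 1 := by
    ext n
    cases n with
    | zero => simp [sub_mul, mul_assoc]
    | succ n =>
      rw [sub_mul, one_mul, mul_assoc, map_sub, PowerSeries.coeff_succ_X_mul,
        PowerSeries.coeff_C_mul]
      simp [PowerSeries.coeff_one, pow_succ']
  rw [homSeries_cons]
  linear_combination homSeries s * h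

/-- Cancellation of a common factor of numerator and denominator; on coefficients it is the
recursion `homSeries_cons_sub`. The three cases record which terms fall below the cut-off of the
expansion. -/
theorem resInfty_X_sub_C_mul (w : R) (s : Multiset R) (F : R[X]) :
    resInfty (w ::ₘ s) ((Polynomial.X - Polynomial.C w) * F) = resInfty s F := by
  suffices h : (resInfty (w ::ₘ s)).comp
      (LinearMap.mulLeft R (Polynomial.X - Polynomial.C w)) = resInfty s from
    LinearMap.congr_fun h F
  ext n
  simp only [LinearMap.comp_apply, LinearMap.mulLeft_apply]
  rw [sub_mul, Polynomial.X_mul_monomial, Polynomial.C_mul_monomial, map_sub, resInfty_monomial,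
    resInfty_monomial, resInfty_monomial]
  have h := homSeries_cons_sub w s
  simp only [Multiset.card_cons, one_mul, mul_one, add_le_add_iff_right]
  rcases lt_trichotomy (n + 1) s.card with h1 | h1 | h1
  · rw [if_neg (by omega), if_neg (by omega), if_neg (by omega)]; simp
  · rw [if_pos (by omega), if_neg (by omega), if_pos (by omega)]
    have := congrArg (PowerSeries.coeff 0) h
    rw [show n + 1 + 1 - (s.card + 1) = 0 by omega, show n + 1 - s.card = 0 by omega, ← this]
    simp [mul_assoc]
  · obtain ⟨k, hk⟩ : ∃ k, n = s.card + k := ⟨n - s.card, by omega⟩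
    rw [if_pos (by omega), if_pos (by omega), if_pos (by omega)]
    have := congrArg (PowerSeries.coeff (k + 1)) h
    rw [map_sub, mul_assoc, PowerSeries.coeff_succ_X_mul, PowerSeries.coeff_C_mul] at this
    rw [show n + 1 + 1 - (s.card + 1) = k + 1 by omega, show n + 1 - (s.card + 1) = k by omega,
      show n + 1 - s.card = k + 1 by omega, ← this]

theorem resInfty_prod_mul (t s : Multiset R) (F : R[X]) :
    resInfty (t + s) ((t.map fun w => Polynomial.X - Polynomial.C w).prod * F) = resInfty s F := by
  induction t using Multiset.induction_on with
  | empty => simp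
  | cons w t ih =>
    rw [Multiset.cons_add, Multiset.map_cons, Multiset.prod_cons, mul_assoc,
      resInfty_X_sub_C_mul, ih]

/-- Without a denominator there is only a polynomial, which has no `p⁻¹` term. -/
theorem resInfty_zero (F : R[X]) : resInfty (0 : Multiset R) F = 0 := by
  have : resInfty (0 : Multiset R) = 0 := by
    ext n
    simp [resInfty_monomial, homSeries, PowerSeries.coeff_one]
  rw [this, LinearMap.zero_apply]

/-- The denominator is monic, so for a proper fraction only the highest possible coefficient of the
numerator reaches `p⁻¹`. -/
theorem resInfty_of_degree_lt (s : Multiset R) (F : R[X]) (hF : F.degree < s.card) :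
    resInfty s F = F.coeff (s.card - 1) := by
  by_cases h0 : s.card = 0
  · have : F = 0 := by
      rw [h0] at hF
      exact Polynomial.degree_eq_bot.mp (Nat.WithBot.lt_zero_iff.mp (by exact_mod_cast hF))
    simp [this]
  obtain ⟨N, hN⟩ : ∃ N, s.card = N + 1 := ⟨s.card - 1, by omega⟩
  rw [hN] at hF ⊢
  have hF' : F.natDegree < N + 1 := by
    by_cases hz : F = 0
    · simp [hz]
    · exact (Polynomial.natDegree_lt_iff_degree_lt hz).mpr hF
  conv_lhs => rw [Polynomial.as_sum_range' F (N + 1) hF']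
  rw [map_sum, Finset.sum_range_succ, Finset.sum_eq_zero, zero_add, resInfty_monomial, hN]
  · have h1 : PowerSeries.coeff 0 (homSeries s) = 1 := by
      rw [PowerSeries.coeff_zero_eq_constantCoeff, homSeries, map_multiset_prod, Multiset.map_map]
      apply Multiset.prod_eq_one
      intro x hx
      obtain ⟨w, _, rfl⟩ := Multiset.mem_map.mp hx
      rw [Function.comp_apply, ← PowerSeries.coeff_zero_eq_constantCoeff, PowerSeries.coeff_mk,
        pow_zero]
    simp [h1]
  · intro n hn
    rw [resInfty_monomial, hN, if_neg (by have := Finset.mem_range.mp hn; omega), mul_zero]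

theorem map_resInfty {S : Type*} [CommRing S] (f : R →+* S) (s : Multiset R) (F : R[X]) :
    f (resInfty s F) = resInfty (s.map f) (F.map f) := by
  have h : PowerSeries.map f (homSeries s) = homSeries (s.map f) := by
    rw [homSeries, homSeries, map_multiset_prod, Multiset.map_map, Multiset.map_map]
    congr 2
    ext w n
    simp
  induction F using Polynomial.induction_on' with
  | add p q hp hq => rw [map_add, map_add, hp, hq, Polynomial.map_add, map_add]
  | monomial n c =>
    rw [Polynomial.map_monomial, resInfty_monomial, resInfty_monomial, map_mul, Multiset.card_map,
      apply_ite f, map_zero, ← h, PowerSeries.coeff_map]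

theorem coeff_homSeries {ι : Type*} [Fintype ι] [DecidableEq ι] (c : ι → R) (m : ℕ) :
    PowerSeries.coeff m (homSeries (Finset.univ.val.map c)) =
      ∑ a ∈ Finset.piAntidiag Finset.univ m, ∏ j, c j ^ a j := by
  rw [homSeries, Multiset.map_map]
  change PowerSeries.coeff m (∏ j, PowerSeries.mk (c j ^ ·)) = _
  rw [PowerSeries.coeff_prod]
  refine Finset.sum_equiv Finsupp.equivFunOnFinite (fun l => ?_) (fun l _ => ?_)
  · simp [Finset.mem_finsuppAntidiag, Finset.mem_piAntidiag]
  · simp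

end Residue

/-! ### Moments of the Fubini–Study measure -/

/-- Multinomial expansion into Dirichlet integrands. The coordinate of index 0 is 1 on the chart, so
its exponent `a 0` survives only in the denominator, as the parameter `c`. -/
theorem moment_pointwise {N : ℕ} (w : Fin (N + 1) → ℝ) (m : ℕ) (u : Fin N → ℂ) :
    ((∑ j, w j * Complex.normSq (chart u j)) / (1 + ∑ j, Complex.normSq (u j))) ^ m *
        (N.factorial / Real.pi ^ N / (1 + ∑ j, Complex.normSq (u j)) ^ (N + 1)) =
      ∑ a ∈ Finset.piAntidiag Finset.univ m,
        ((Nat.multinomial Finset.univ a : ℝ) * (∏ j, w j ^ a j) * (N.factorial / Real.pi ^ N)) *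
        ((∏ j : Fin N, Complex.normSq (u j) ^ a j.succ) /
          (1 + ∑ j, Complex.normSq (u j)) ^ (a 0 + ∑ j : Fin N, a j.succ + N + 1)) := by
  have hr := sum_normSq_chart_pos u
  rw [sum_normSq_chart] at hr
  have hpi := Real.pi_ne_zero
  rw [div_pow, Finset.sum_pow_eq_sum_piAntidiag, Finset.sum_div, Finset.sum_mul]
  refine Finset.sum_congr rfl fun a ha => ?_
  have hs : a 0 + ∑ j : Fin N, a j.succ = m := by
    rw [← Fin.sum_univ_succ]; exact (Finset.mem_piAntidiag.mp ha).1
  rw [hs]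
  simp only [mul_pow, Finset.prod_mul_distrib]
  have : ∏ j, Complex.normSq (chart u j) ^ a j = ∏ j : Fin N, Complex.normSq (u j) ^ a j.succ := by
    simp [Fin.prod_univ_succ, chart]
  rw [this]
  field_simp
  ring

theorem integrable_moment {N : ℕ} (w : Fin (N + 1) → ℝ) (m : ℕ) :
    Integrable fun u : Fin N → ℂ =>
      ((∑ j, w j * Complex.normSq (chart u j)) / (1 + ∑ j, Complex.normSq (u j))) ^ m *
        (N.factorial / Real.pi ^ N / (1 + ∑ j, Complex.normSq (u j)) ^ (N + 1)) := by
  simp only [moment_pointwise]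
  exact integrable_finsetSum _ fun a _ =>
    (integrable_prod_normSq_pow_div (fun j => a j.succ) (a 0)).const_mul _

/-- The binomial coefficient, which comes from expanding the power `m + N` of the curvature, cancels
the multinomial coefficient against the factorials of the Dirichlet integral. Every monomial is left
with coefficient one. -/
theorem integral_moment {N : ℕ} (w : Fin (N + 1) → ℝ) (m : ℕ) :
    ((m + N).choose N : ℝ) * ∫ u : Fin N → ℂ,
      ((∑ j, w j * Complex.normSq (chart u j)) / (1 + ∑ j, Complex.normSq (u j))) ^ m *
        (N.factorial / Real.pi ^ N / (1 + ∑ j, Complex.normSq (u j)) ^ (N + 1)) =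
      ∑ a ∈ Finset.piAntidiag Finset.univ m, ∏ j, w j ^ a j := by
  simp only [moment_pointwise]
  rw [integral_finsetSum _ fun a _ =>
    (integrable_prod_normSq_pow_div (fun j => a j.succ) (a 0)).const_mul _, Finset.mul_sum]
  refine Finset.sum_congr rfl fun a ha => ?_
  have hs : a 0 + ∑ j : Fin N, a j.succ = m := by
    rw [← Fin.sum_univ_succ]; exact (Finset.mem_piAntidiag.mp ha).1
  rw [integral_const_mul, integral_prod_normSq_pow_div (fun j => a j.succ) (a 0), hs]
  have h1 := Nat.multinomial_spec Finset.univ a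
  rw [Fin.prod_univ_succ, Fin.sum_univ_succ, hs] at h1
  have h2 := Nat.add_choose_mul_factorial_mul_factorial m N
  rw [← Nat.choose_symm_add] at h2
  have h1' : ((a 0).factorial : ℝ) * (∏ j : Fin N, ((a j.succ).factorial : ℝ)) *
      Nat.multinomial Finset.univ a = m.factorial := by exact_mod_cast h1
  have h2' : ((m + N).choose m : ℝ) * m.factorial * N.factorial = (m + N).factorial := by
    exact_mod_cast h2
  have hpi := Real.pi_ne_zero
  have h3 : ((m + N).factorial : ℝ) ≠ 0 := by exact_mod_cast Nat.factorial_ne_zero _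
  have h4 : (m + N).choose N = (m + N).choose m := (Nat.choose_symm_add).symm
  rw [h4]
  field_simp
  calc _ = (∏ j, w j ^ a j) * (((m + N).choose m : ℝ) * (((a 0).factorial : ℝ) *
        (∏ j : Fin N, ((a j.succ).factorial : ℝ)) * Nat.multinomial Finset.univ a) *
          N.factorial) := by ring
    _ = _ := by rw [h1', h2']

/-! ### Equivariant integration over projective space -/

theorem generator_apply {N : ℕ} (w : Fin (N + 1) → ℕ) (x : HomCoord N) (j : Fin (N + 1)) :
    generator w x j = Complex.I * w j * x j := by
  have h : HasDerivAt (fun t : ℝ => rotate w t x) (fun j => Complex.I * w j * x j) 0 := by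
    rw [hasDerivAt_pi]
    intro j
    have h1 : HasDerivAt (fun t : ℝ => Complex.I * (t : ℂ) * (w j : ℂ)) (Complex.I * 1 * w j) 0 :=
      ((Complex.ofRealCLM.hasDerivAt (x := (0 : ℝ))).const_mul Complex.I).mul_const _
    have h2 := (h1.cexp).mul_const (x j)
    refine h2.congr_deriv ?_
    simp
  rw [generator, h.deriv]

/-- The moment map `μ` of the action: a weighted mean of the weights. -/
theorem two_pi_mul_hopfConnection_generator {N : ℕ} (w : Fin (N + 1) → ℕ) (u : Fin N → ℂ) :
    2 * Real.pi * hopfConnection (chart u) (generator w (chart u)) =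
      (∑ j, (w j : ℝ) * Complex.normSq (chart u j)) / (1 + ∑ j, Complex.normSq (u j)) := by
  have hr := sum_normSq_chart_pos u
  rw [sum_normSq_chart] at hr
  have hpi := Real.pi_ne_zero
  have h : (∑ j, ((chart u j).re • dIm j - (chart u j).im • dRe j) : HomCoord N →L[ℝ] ℝ)
      (generator w (chart u)) = ∑ j, (w j : ℝ) * Complex.normSq (chart u j) := by
    rw [_root_.sum_apply]
    refine Finset.sum_congr rfl fun j _ => ?_
    simp [dIm_apply, dRe_apply, generator_apply, Complex.normSq_apply]
    ring
  rw [hopfConnection, _root_.smul_apply, h, sum_normSq_chart, smul_eq_mul]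
  field_simp

theorem equivIntegral_coeff {N : ℕ} (α : EquivForm N) (l : ℕ) :
    (equivIntegral α).coeff l =
      ∫ u : Fin N → ℂ, evalForm (chartFrame N) (α.coeff l (chart u)) := by
  rw [equivIntegral, Polynomial.sum, Polynomial.finsetSum_coeff]
  simp only [Polynomial.coeff_monomial]
  rw [Finset.sum_ite_eq']
  split_ifs with h
  · rfl
  · simp [Polynomial.notMem_support_iff.mp h]

/-- Equivariant forms are a noncommutative ring, so substituting `p` into a polynomial needs
coefficients that commute with it. -/
theorem commute_map_algebraMap {N : ℕ} (f : ℝ[X]) (x : EquivForm N) :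
    Commute (Polynomial.mapRingHom (algebraMap ℝ (HomCoord N → Form N)) f) x := by
  induction f using Polynomial.induction_on' with
  | add p q hp hq => rw [map_add]; exact hp.add_left hq
  | monomial n c =>
    rw [Polynomial.coe_mapRingHom, Polynomial.map_monomial, ← Polynomial.C_mul_X_pow_eq_monomial]
    have h : Commute (algebraMap ℝ (EquivForm N) c) x := Algebra.commutes c x
    exact h.mul_left (Polynomial.commute_X_pow x n)

/-- Substitution of the class `p` into a polynomial with coefficients in `H^*(BS¹) = ℝ[ħ]`. -/
def evalP {N : ℕ} (w : Fin (N + 1) → ℕ) : ℝ[X][X] →+* EquivForm N :=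
  Polynomial.eval₂RingHom' (Polynomial.mapRingHom (algebraMap ℝ (HomCoord N → Form N)))
    (pForm w) fun f => commute_map_algebraMap f _

theorem evalP_X {N : ℕ} (w : Fin (N + 1) → ℕ) : evalP w Polynomial.X = pForm w :=
  Polynomial.eval₂_X _ _

theorem evalP_C {N : ℕ} (w : Fin (N + 1) → ℕ) (f : ℝ[X]) :
    evalP w (Polynomial.C f) = f.map (algebraMap ℝ (HomCoord N → Form N)) :=
  Polynomial.eval₂_C _ _

/-- In the binomial expansion of `(ω + μħ) ^ n` only the term with `ω ^ N` has degree `2N`; the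
other `n - N` factors contribute `μħ`. -/
theorem evalForm_coeff_evalP_monomial {N : ℕ} (w : Fin (N + 1) → ℕ) (n i : ℕ) (c : ℝ) (l : ℕ)
    (u : Fin N → ℂ) :
    evalForm (chartFrame N)
      ((evalP w (Polynomial.monomial n (Polynomial.monomial i c))).coeff l (chart u)) =
    if N ≤ n ∧ l = i + (n - N) then
      c * n.choose N *
      (((∑ j, (w j : ℝ) * Complex.normSq (chart u j)) /
        (1 + ∑ j, Complex.normSq (u j))) ^ (n - N) *
        (N.factorial / Real.pi ^ N / (1 + ∑ j, Complex.normSq (u j)) ^ (N + 1)))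
    else 0 := by
  rw [← Polynomial.C_mul_X_pow_eq_monomial, map_mul, map_pow, evalP_X, evalP_C,
    Polynomial.map_monomial, ← Polynomial.C_mul_X_pow_eq_monomial]
  set μ : HomCoord N → ℝ := fun x => 2 * Real.pi * hopfConnection x (generator w x) with hμ
  set M : HomCoord N → Form N := fun x => algebraMap ℝ (Form N) (μ x) with hM
  set ω : HomCoord N → Form N := extD hopfConnection
  have hp : pForm w = Polynomial.C ω + Polynomial.C M * Polynomial.X := rfl
  have hcM : ∀ a : HomCoord N → Form N, Commute a M := fun a => by
    ext1 x
    exact (Algebra.commutes (μ x) (a x)).symm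
  have hc : Commute (Polynomial.C ω) (Polynomial.C M * Polynomial.X) :=
    ((hcM ω).map Polynomial.C).mul_right (Polynomial.commute_X _).symm
  have hterm : ∀ k, Polynomial.C ω ^ k * (Polynomial.C M * Polynomial.X) ^ (n - k) *
      ((n.choose k : ℕ) : EquivForm N) =
      Polynomial.C (ω ^ k * M ^ (n - k) * (n.choose k : HomCoord N → Form N)) *
        Polynomial.X ^ (n - k) := fun k => by
    rw [(Polynomial.commute_X (Polynomial.C M)).symm.mul_pow, ← Polynomial.C_pow, ← Polynomial.C_pow,
      ← Polynomial.C_eq_natCast, ← mul_assoc, ← Polynomial.C_mul, mul_assoc,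
      Polynomial.X_pow_mul_C, ← mul_assoc, ← Polynomial.C_mul]
  rw [hp, hc.add_pow, Finset.mul_sum, Polynomial.finsetSum_coeff, Finset.sum_apply, map_sum]
  have hcoeff : ∀ k ∈ Finset.range (n + 1), evalForm (chartFrame N)
      ((Polynomial.C (algebraMap ℝ (HomCoord N → Form N) c) * Polynomial.X ^ i *
        (Polynomial.C ω ^ k * (Polynomial.C M * Polynomial.X) ^ (n - k) *
          ((n.choose k : ℕ) : EquivForm N))).coeff l (chart u)) =
      if k = N then (if l = i + (n - k) then c * n.choose k * (μ (chart u) ^ (n - k) *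
        evalForm (chartFrame N) (ω (chart u) ^ k)) else 0) else 0 := fun k _ => by
    rw [hterm, mul_assoc, Polynomial.coeff_C_mul, ← mul_assoc, Polynomial.X_pow_mul_C, mul_assoc,
      ← pow_add, Polynomial.coeff_C_mul, Polynomial.coeff_X_pow]
    have h1 : evalForm (chartFrame N) ((algebraMap ℝ (HomCoord N → Form N) c *
        (ω ^ k * M ^ (n - k) * (n.choose k : HomCoord N → Form N) *
          if l = i + (n - k) then 1 else 0)) (chart u)) =
        if l = i + (n - k) then c * n.choose k * (μ (chart u) ^ (n - k) *
        evalForm (chartFrame N) (ω (chart u) ^ k)) else 0 := by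
      split_ifs with hl
      · have h2 : (algebraMap ℝ (HomCoord N → Form N) c *
            (ω ^ k * M ^ (n - k) * (n.choose k : HomCoord N → Form N) * 1)) (chart u) =
            (c * n.choose k * μ (chart u) ^ (n - k)) • ω (chart u) ^ k := by
          simp only [Pi.mul_apply, Pi.pow_apply, mul_one, hM, Pi.natCast_apply]
          rw [← map_pow, ← map_natCast (algebraMap ℝ (Form N)), mul_assoc (ω (chart u) ^ k),
            ← map_mul, ← Algebra.commutes, ← mul_assoc, Algebra.smul_def]
          change algebraMap ℝ (Form N) c * _ * _ = _
          rw [← map_mul]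
          congr 2
          ring
        rw [h2, map_smul, smul_eq_mul]
        ring
      · simp
    rw [h1]
    by_cases hk : k = N
    · rw [if_pos hk]
    · rw [if_neg hk, evalForm_extD_pow_eq_zero _ (by omega)]
      simp
  rw [Finset.sum_congr rfl hcoeff, Finset.sum_ite_eq']
  simp only [Finset.mem_range, Nat.lt_succ_iff]
  rw [ite_and]
  simp only [evalForm_extD_hopfConnection_pow, ω, hμ, two_pi_mul_hopfConnection_generator]

/-- Equivariant integration over projective space is the residue at infinity. -/
theorem equivIntegral_evalP {N : ℕ} (w : Fin (N + 1) → ℕ) (F : ℝ[X][X]) :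
    equivIntegral (evalP w F) =
      resInfty (Finset.univ.val.map fun j => Polynomial.C (w j : ℝ) * Polynomial.X) F := by
  -- Integrability is carried along because additivity of the integral depends on it.
  suffices h : (∀ l, Integrable fun u : Fin N → ℂ =>
      evalForm (chartFrame N) ((evalP w F).coeff l (chart u))) ∧ equivIntegral (evalP w F) =
      resInfty (Finset.univ.val.map fun j => Polynomial.C (w j : ℝ) * Polynomial.X) F from h.2
  have hadd : ∀ F G : ℝ[X][X], ((∀ l, Integrable fun u : Fin N → ℂ =>
      evalForm (chartFrame N) ((evalP w F).coeff l (chart u))) ∧ equivIntegral (evalP w F) =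
      resInfty (Finset.univ.val.map fun j => Polynomial.C (w j : ℝ) * Polynomial.X) F) →
      ((∀ l, Integrable fun u : Fin N → ℂ =>
      evalForm (chartFrame N) ((evalP w G).coeff l (chart u))) ∧ equivIntegral (evalP w G) =
      resInfty (Finset.univ.val.map fun j => Polynomial.C (w j : ℝ) * Polynomial.X) G) →
      ((∀ l, Integrable fun u : Fin N → ℂ =>
      evalForm (chartFrame N) ((evalP w (F + G)).coeff l (chart u))) ∧
      equivIntegral (evalP w (F + G)) =
      resInfty (Finset.univ.val.map fun j => Polynomial.C (w j : ℝ) * Polynomial.X) (F + G)) := by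
    rintro F G ⟨hF, hF'⟩ ⟨hG, hG'⟩
    have e : ∀ l (u : Fin N → ℂ), evalForm (chartFrame N)
        ((evalP w (F + G)).coeff l (chart u)) =
        evalForm (chartFrame N) ((evalP w F).coeff l (chart u)) +
        evalForm (chartFrame N) ((evalP w G).coeff l (chart u)) := fun l u => by
      rw [map_add, Polynomial.coeff_add, Pi.add_apply, map_add]
    constructor
    · intro l
      simp only [e]
      exact (hF l).add (hG l)
    · rw [map_add (resInfty _), ← hF', ← hG']
      ext l
      rw [Polynomial.coeff_add, equivIntegral_coeff, equivIntegral_coeff, equivIntegral_coeff]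
      simp only [e]
      exact integral_add (hF l) (hG l)
  induction F using Polynomial.induction_on' with
  | add p q hp hq => exact hadd p q hp hq
  | monomial n f =>
    induction f using Polynomial.induction_on' with
    | add p q hp hq =>
      rw [map_add (Polynomial.monomial n)]
      exact hadd _ _ hp hq
    | monomial i c =>
      constructor
      · intro l
        simp only [evalForm_coeff_evalP_monomial]
        split_ifs
        · exact (integrable_moment (fun j => (w j : ℝ)) (n - N)).const_mul _
        · exact integrable_zero _ _ _
      · ext l
        rw [equivIntegral_coeff, resInfty_monomial, coeff_homSeries]
        simp only [evalForm_coeff_evalP_monomial, Multiset.card_map, Finset.card_val,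
          Finset.card_univ, Fintype.card_fin, add_le_add_iff_right, Nat.add_sub_add_right]
        by_cases hn : N ≤ n
        · have h1 : ∀ a ∈ Finset.piAntidiag (Finset.univ : Finset (Fin (N + 1))) (n - N),
              ∏ j, (Polynomial.C (w j : ℝ) * Polynomial.X) ^ a j =
              Polynomial.C (∏ j, (w j : ℝ) ^ a j) * Polynomial.X ^ (n - N) := fun a ha => by
            simp only [mul_pow, Finset.prod_mul_distrib, Finset.prod_pow_eq_pow_sum, map_prod,
              map_pow]
            rw [(Finset.mem_piAntidiag.mp ha).1]
          rw [if_pos hn, Finset.sum_congr rfl h1, ← Finset.sum_mul, ← map_sum,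
            ← integral_moment (fun j => (w j : ℝ)) (n - N), Nat.sub_add_cancel hn,
            ← Polynomial.C_mul_X_pow_eq_monomial]
          have h2 : ∀ y : ℝ, (Polynomial.C c * Polynomial.X ^ i *
              (Polynomial.C y * Polynomial.X ^ (n - N))).coeff l =
              if l = i + (n - N) then c * y else 0 := fun y => by
            rw [show Polynomial.C c * Polynomial.X ^ i * (Polynomial.C y * Polynomial.X ^ (n - N)) =
              Polynomial.C (c * y) * Polynomial.X ^ (i + (n - N)) by
                rw [Polynomial.C_mul, pow_add]; ring, Polynomial.coeff_C_mul_X_pow]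
          rw [h2]
          by_cases hl : l = i + (n - N)
          · simp only [hn, hl, and_self, if_true]
            rw [integral_const_mul, mul_assoc]
          · simp [hl]
        · simp [hn]

/-! ### Residues at the fixed points -/

section FixedPoints

variable {K : Type*} [Field K]

theorem aeval_clsP (F : K[X]) :
    Polynomial.aeval (clsP K) F = AdjoinRoot.mk (Polynomial.X ^ 4 : K[X]) F :=
  AdjoinRoot.aeval_eq F

theorem aeval_clsP_add (c : K) (F : K[X]) :
    Polynomial.aeval (clsP K + algebraMap K (QuinticAlg K) c) F =
      Polynomial.aeval (clsP K) (F.comp (Polynomial.X + Polynomial.C c)) := by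
  rw [Polynomial.aeval_comp]
  simp

/-- A translation of the variable does not change the cubic coefficient of a polynomial of degree at
most three. -/
theorem comp_three_aeval (c : K) {r : K[X]} (hr : r.degree < 4) :
    comp 3 (Polynomial.aeval (clsP K + algebraMap K (QuinticAlg K) c) r) = r.coeff 3 := by
  rw [aeval_clsP_add, aeval_clsP, comp_mk (by norm_num)]
  have hr' : r.natDegree < 4 := by
    by_cases hz : r = 0
    · simp [hz]
    · exact (Polynomial.natDegree_lt_iff_degree_lt hz).mpr hr
  conv_lhs => rw [Polynomial.as_sum_range' r 4 hr']
  simp only [Finset.sum_range_succ, Finset.sum_range_zero, zero_add, Polynomial.add_comp,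
    Polynomial.monomial_comp, Polynomial.coeff_add, Polynomial.coeff_C_mul,
    Polynomial.coeff_X_add_C_pow]
  simp [Nat.choose]

theorem isUnit_aeval_prod_erase [CharZero K] {h : K} (hh : h ≠ 0) (s : Finset ℕ) (k : ℕ) :
    IsUnit (Polynomial.aeval (clsP K + algebraMap K (QuinticAlg K) (k * h))
      (∏ m ∈ s.erase k, (Polynomial.X - Polynomial.C ((m : K) * h)))) := by
  rw [map_prod, IsUnit.prod_iff]
  intro m hm
  have hne : m ≠ k := (Finset.mem_erase.mp hm).1
  have e : Polynomial.aeval (clsP K + algebraMap K (QuinticAlg K) (k * h))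
      (Polynomial.X - Polynomial.C ((m : K) * h)) =
      clsP K + algebraMap K (QuinticAlg K) (((k : K) - m) * h) := by
    rw [map_sub, Polynomial.aeval_X, Polynomial.aeval_C, sub_mul, map_sub]
    ring
  rw [e]
  refine isUnit_clsP_add (mul_ne_zero (sub_ne_zero.mpr ?_) hh)
  exact_mod_cast hne.symm

theorem aeval_X_sub_C_self_pow_four (c : K) :
    Polynomial.aeval (clsP K + algebraMap K (QuinticAlg K) c)
      ((Polynomial.X - Polynomial.C c) ^ 4) = 0 := by
  simp [clsP_pow_four]

/-- The residue at infinity is the sum of the residues at the finite poles, all of order four. -/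
theorem resInfty_eq_sum [CharZero K] {h : K} (hh : h ≠ 0) (s : Finset ℕ) (F : K[X]) :
    resInfty (4 • s.val.map fun k : ℕ => (k : K) * h) F = ∑ k ∈ s,
      comp 3 (Polynomial.aeval (clsP K + algebraMap K (QuinticAlg K) (k * h)) F *
        Ring.inverse (Polynomial.aeval (clsP K + algebraMap K (QuinticAlg K) (k * h))
          (∏ m ∈ s.erase k, (Polynomial.X - Polynomial.C ((m : K) * h)))) ^ 4) := by
  set g : ℕ → K[X] := fun k => (Polynomial.X - Polynomial.C ((k : K) * h)) ^ 4 with hg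
  have hinj : Function.Injective fun k : ℕ => (k : K) * h := fun a b hab => by
    exact_mod_cast mul_right_cancel₀ hh hab
  have hcop : Set.Pairwise (s : Set ℕ) fun i j => IsCoprime (g i) (g j) := fun i _ j _ hij =>
    (Polynomial.pairwise_coprime_X_sub_C hinj hij).pow
  have hmon : ∀ i ∈ s, (g i).Monic := fun i _ => (Polynomial.monic_X_sub_C _).pow 4
  -- Partial fractions. The quotient has no residue, and each proper part `r i / (p - ih) ^ 4`
  -- contributes the cubic coefficient of `r i`.
  obtain ⟨q, r, hr, hF⟩ := Polynomial.eq_quo_mul_prod_add_sum_rem_mul_prod F hmon hcop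
  have hr4 : ∀ i ∈ s, (r i).degree < 4 := fun i hi => by
    have := hr i hi
    rwa [hg, Polynomial.degree_pow, Polynomial.degree_X_sub_C] at this
  have hprod : ∀ t : Finset ℕ, ((4 • t.val.map fun k : ℕ => (k : K) * h).map
      fun w => Polynomial.X - Polynomial.C w).prod = ∏ k ∈ t, g k := fun t => by
    rw [Multiset.map_nsmul, Multiset.prod_nsmul, Multiset.map_map, Finset.prod_pow]
    rfl
  have hq : resInfty (4 • s.val.map fun k : ℕ => (k : K) * h) (q * ∏ k ∈ s, g k) = 0 := by
    have := resInfty_prod_mul (4 • s.val.map fun k : ℕ => (k : K) * h) 0 q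
    rwa [hprod, add_zero, resInfty_zero, mul_comm] at this
  have hri : ∀ i ∈ s, resInfty (4 • s.val.map fun k : ℕ => (k : K) * h)
      (r i * ∏ k ∈ s.erase i, g k) = (r i).coeff 3 := fun i hi => by
    have e : (4 • s.val.map fun k : ℕ => (k : K) * h) =
        (4 • (s.erase i).val.map fun k : ℕ => (k : K) * h) + 4 • {(i : K) * h} := by
      rw [← nsmul_add, Finset.erase_val, add_comm, Multiset.singleton_add,
        ← Multiset.map_cons (fun k : ℕ => (k : K) * h), Multiset.cons_erase hi]
    rw [e, mul_comm (r i), ← hprod, resInfty_prod_mul, resInfty_of_degree_lt]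
    · simp
    · simpa using hr4 i hi
  -- Evaluation at `P + kh` kills `(p - kh) ^ 4`, hence every summand except the one with numerator
  -- `r k`.
  set ev : ℕ → K[X] →ₐ[K] QuinticAlg K := fun k =>
    Polynomial.aeval (clsP K + algebraMap K (QuinticAlg K) (k * h)) with hev
  have hev0 : ∀ k, ev k (g k) = 0 := fun k => aeval_X_sub_C_self_pow_four _
  have hq' : ∀ k ∈ s, ev k (q * ∏ k ∈ s, g k) = 0 := fun k hk => by
    rw [map_mul, map_prod, Finset.prod_eq_zero hk (hev0 k), mul_zero]
  have hri' : ∀ k ∈ s, ev k (∑ i ∈ s, r i * ∏ m ∈ s.erase i, g m) =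
      ev k (r k) * ev k (∏ m ∈ s.erase k, (Polynomial.X - Polynomial.C ((m : K) * h))) ^ 4 :=
    fun k hk => by
      rw [map_sum, Finset.sum_eq_single k]
      · rw [map_mul, ← map_pow, ← Finset.prod_pow]
      · intro i _ hik
        rw [map_mul, map_prod (ev k), Finset.prod_eq_zero
          (Finset.mem_erase.mpr ⟨hik.symm, hk⟩) (hev0 k), mul_zero]
      · exact fun hk' => (hk' hk).elim
  conv_lhs => rw [hF]
  rw [map_add, hq, zero_add, map_sum, Finset.sum_congr rfl hri]
  refine Finset.sum_congr rfl fun k hk => ?_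
  change _ = comp 3 (ev k F * _)
  rw [hF, map_add, hq' k hk, zero_add, hri' k hk, mul_assoc, ← mul_pow,
    Ring.mul_inverse_cancel _ (isUnit_aeval_prod_erase hh s k), one_pow, mul_one]
  exact (comp_three_aeval _ (hr4 k hk)).symm

/-- The integers from `a` down to `-b`, split by sign. The positive part will belong to `I` at `ħ`,
the negative part to `I` at `-ħ`. -/
theorem prod_range_sub_eq {M : Type*} [CommMonoid M] (f : ℤ → M) (a b : ℕ) :
    ∏ j ∈ Finset.range (a + b + 1), f ((a : ℤ) - j) =
      f 0 * (∏ m ∈ Finset.Icc 1 a, f m) * ∏ m ∈ Finset.Icc 1 b, f (-m) := by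
  induction b with
  | zero =>
    simp only [add_zero, zero_lt_one, Finset.Icc_eq_empty_of_lt, Finset.prod_empty, mul_one]
    induction a with
    | zero => simp
    | succ a ih =>
      rw [Finset.prod_range_succ', Finset.prod_Icc_succ_top (by omega), ← mul_assoc, ← ih]
      congr 1
      refine Finset.prod_congr rfl fun j _ => ?_
      push_cast
      congr 1
      ring
  | succ b ih =>
    rw [← add_assoc, Finset.prod_range_succ, ih, Finset.prod_Icc_succ_top (by omega), ← mul_assoc]
    congr 2
    push_cast
    ring

/-- The Euler class of `LV_d` as a polynomial in `p`. -/
def eulerPoly (h : K) (d : ℕ) : K[X] :=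
  ∏ j ∈ Finset.range (5 * d + 1), (5 * Polynomial.X - Polynomial.C ((j : K) * h))

/-- The factor of index `5k` is `5(p - kh)`. It lowers the pole at `kh` from order five to order
four, which is why the relation `P^4 = 0` suffices. -/
theorem prod_X_sub_C_dvd_eulerPoly (h : K) (d : ℕ) :
    (∏ k ∈ Finset.range (d + 1), (Polynomial.X - Polynomial.C ((k : K) * h))) ∣ eulerPoly h d := by
  induction d with
  | zero => simp [eulerPoly]
  | succ d ih =>
    rw [Finset.prod_range_succ _ (d + 1), eulerPoly, show 5 * (d + 1) + 1 = 5 * d + 1 + 4 + 1 by ring,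
      Finset.prod_range_succ _ (5 * d + 1 + 4),
      Finset.prod_range_add _ (5 * d + 1) 4]
    refine mul_dvd_mul (ih.mul_right _) ⟨5, ?_⟩
    have : ((5 * d + 1 + 4 : ℕ) : K) * h = 5 * (((d + 1 : ℕ) : K) * h) := by push_cast; ring
    rw [this, Polynomial.C_mul]
    have h5 : Polynomial.C (5 : K) = 5 := map_ofNat _ 5
    rw [h5]
    ring

theorem eulerPoly_comp (h : K) (k b : ℕ) :
    (eulerPoly h (k + b)).comp (Polynomial.X + Polynomial.C ((k : K) * h)) =
      5 * Polynomial.X *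
      (∏ m ∈ Finset.Icc 1 (5 * k), (5 * Polynomial.X + Polynomial.C ((m : K) * h))) *
      ∏ m ∈ Finset.Icc 1 (5 * b), (5 * Polynomial.X + Polynomial.C ((m : K) * -h)) := by
  have := prod_range_sub_eq (fun z : ℤ => 5 * Polynomial.X + Polynomial.C ((z : K) * h))
    (5 * k) (5 * b)
  simp only [Int.cast_zero, zero_mul, map_zero, add_zero, Int.cast_neg, Int.cast_natCast] at this
  rw [eulerPoly, Polynomial.prod_comp, mul_add]
  refine Eq.trans (Finset.prod_congr rfl fun j _ => ?_) (this.trans ?_)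
  · simp only [Polynomial.sub_comp, Polynomial.mul_comp, Polynomial.X_comp, Polynomial.C_comp,
      Polynomial.ofNat_comp]
    push_cast
    simp only [map_sub, map_mul, sub_mul, map_natCast, map_ofNat]
    ring
  · congr 1
    refine Finset.prod_congr rfl fun j _ => ?_
    rw [neg_mul, mul_neg]

theorem prod_X_sub_C_comp (h : K) (k b : ℕ) :
    (∏ j ∈ Finset.range (k + b + 1), (Polynomial.X - Polynomial.C ((j : K) * h))).comp
        (Polynomial.X + Polynomial.C ((k : K) * h)) =
      Polynomial.X *
      (∏ m ∈ Finset.Icc 1 k, (Polynomial.X + Polynomial.C ((m : K) * h))) *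
      ∏ m ∈ Finset.Icc 1 b, (Polynomial.X + Polynomial.C ((m : K) * -h)) := by
  have := prod_range_sub_eq (fun z : ℤ => Polynomial.X + Polynomial.C ((z : K) * h)) k b
  simp only [Int.cast_zero, zero_mul, map_zero, add_zero, Int.cast_neg, Int.cast_natCast] at this
  rw [Polynomial.prod_comp]
  refine Eq.trans (Finset.prod_congr rfl fun j _ => ?_) (this.trans ?_)
  · simp only [Polynomial.sub_comp, Polynomial.X_comp, Polynomial.C_comp]
    push_cast
    simp only [map_sub, map_mul, sub_mul, map_natCast]
    ring
  · congr 1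
    refine Finset.prod_congr rfl fun j _ => ?_
    rw [neg_mul, mul_neg]

/-- The contribution of the fixed point component of weight `k`. -/
theorem aeval_euler_mul_inverse [CharZero K] {h : K} (hh : h ≠ 0) (k b : ℕ) (G : K[X])
    (hG : eulerPoly h (k + b) =
      (∏ j ∈ Finset.range (k + b + 1), (Polynomial.X - Polynomial.C ((j : K) * h))) * G) :
    Polynomial.aeval (clsP K + algebraMap K (QuinticAlg K) (k * h)) G *
        Ring.inverse (Polynomial.aeval (clsP K + algebraMap K (QuinticAlg K) (k * h))
          (∏ m ∈ (Finset.range (k + b + 1)).erase k,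
            (Polynomial.X - Polynomial.C ((m : K) * h)))) ^ 4 =
      5 * (hyperCoeff h k * hyperCoeff (-h) b) := by
  have hu := isUnit_aeval_prod_erase hh (Finset.range (k + b + 1)) k
  have hk : k ∈ Finset.range (k + b + 1) := by simp
  set V := ∏ m ∈ (Finset.range (k + b + 1)).erase k, (Polynomial.X - Polynomial.C ((m : K) * h))
  set σ : K[X] := Polynomial.X + Polynomial.C ((k : K) * h)
  have hV : ∏ j ∈ Finset.range (k + b + 1), (Polynomial.X - Polynomial.C ((j : K) * h)) =
      (Polynomial.X - Polynomial.C ((k : K) * h)) * V := (Finset.mul_prod_erase _ _ hk).symm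
  have hX : (Polynomial.X - Polynomial.C ((k : K) * h)).comp σ = Polynomial.X := by
    simp [σ]
  -- Here and in `h2` the factor `X` is cancelled in `K[X]`, before evaluation at `P`, since `P` is
  -- nilpotent.
  have h1 : V.comp σ = (∏ m ∈ Finset.Icc 1 k, (Polynomial.X + Polynomial.C ((m : K) * h))) *
      ∏ m ∈ Finset.Icc 1 b, (Polynomial.X + Polynomial.C ((m : K) * -h)) := by
    have := prod_X_sub_C_comp h k b
    rw [hV, Polynomial.mul_comp, hX, mul_assoc] at this
    exact mul_left_cancel₀ Polynomial.X_ne_zero this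
  have h2 : V.comp σ * G.comp σ =
      5 * ((∏ m ∈ Finset.Icc 1 (5 * k), (5 * Polynomial.X + Polynomial.C ((m : K) * h))) *
      ∏ m ∈ Finset.Icc 1 (5 * b), (5 * Polynomial.X + Polynomial.C ((m : K) * -h))) := by
    have := eulerPoly_comp h k b
    rw [hG, hV, Polynomial.mul_comp, Polynomial.mul_comp, hX] at this
    apply mul_left_cancel₀ (Polynomial.X_ne_zero (R := K))
    linear_combination this
  have h1' := congrArg (Polynomial.aeval (clsP K)) h1
  have h2' := congrArg (Polynomial.aeval (clsP K)) h2
  rw [map_mul, ← aeval_clsP_add, ← aeval_clsP_add] at h2'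
  rw [← aeval_clsP_add] at h1'
  simp only [map_mul, map_prod, map_add, Polynomial.aeval_X, Polynomial.aeval_C, map_ofNat,
    map_neg] at h1' h2'
  have n1 := hyperCoeff_mul_denom hh k
  have n2 := hyperCoeff_mul_denom (neg_ne_zero.mpr hh) b
  simp only [map_mul, map_neg, Finset.prod_pow] at n1 n2
  rw [← n1, ← n2] at h2'
  -- The denominators of the two hypergeometric coefficients multiply to the fifth power of the
  -- value of `V`.
  apply (hu.pow 5).mul_left_injective
  dsimp only
  set v := Polynomial.aeval (clsP K + algebraMap K (QuinticAlg K) (k * h)) V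
  have hinv : Ring.inverse v ^ 4 * v ^ 5 = v := by
    rw [show v ^ 5 = v ^ 4 * v by ring, ← mul_assoc, ← mul_pow, Ring.inverse_mul_cancel _ hu,
      one_pow, one_mul]
  rw [mul_assoc, hinv]
  have hv : v = (∏ m ∈ Finset.Icc 1 k, (clsP K + algebraMap K (QuinticAlg K) m *
      algebraMap K (QuinticAlg K) h)) * ∏ m ∈ Finset.Icc 1 b, (clsP K +
      algebraMap K (QuinticAlg K) m * -algebraMap K (QuinticAlg K) h) := by
    rw [← h1']; simp only [v, map_mul]
  rw [← map_mul (algebraMap K (QuinticAlg K)) (k : K) h] at h2'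
  rw [mul_comm]
  refine h2'.trans ?_
  rw [hv]
  ring

end FixedPoints

/-! ### The pairing of the hypergeometric series -/

section Pairing

variable {K : Type*} [Field K]

theorem algebraMap_rat_eq [CharZero K] {A : Type*} [CommRing A] [Algebra K A] [Algebra ℚ A]
    (n : ℕ) : algebraMap ℚ A (n.factorial : ℚ)⁻¹ = algebraMap K A (n.factorial : K)⁻¹ := by
  have h : algebraMap ℚ A = (algebraMap K A).comp (algebraMap ℚ K) := Subsingleton.elim _ _
  rw [h, RingHom.comp_apply, map_inv₀, map_natCast]

theorem isNilpotent_C_clsP_mul_X (h : K) :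
    (Polynomial.C (h⁻¹ • clsP K) * Polynomial.X : (QuinticAlg K)[X]) ^ 4 = 0 := by
  rw [mul_pow, ← Polynomial.C_pow, _root_.smul_pow, clsP_pow_four]
  simp

theorem expLog_eq_exp [CharZero K] (h : K) :
    expLog h = IsNilpotent.exp (Polynomial.C (h⁻¹ • clsP K) * Polynomial.X) := by
  rw [IsNilpotent.exp_eq_sum (isNilpotent_C_clsP_mul_X h), expLog]
  refine Finset.sum_congr rfl fun j _ => ?_
  rw [Algebra.smul_def, algebraMap_rat_eq (K := K), mul_pow, ← Polynomial.C_pow, ← mul_assoc,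
    Polynomial.algebraMap_apply, ← Polynomial.C_mul, Polynomial.C_mul_X_pow_eq_monomial,
    Algebra.smul_def, mul_pow, map_mul (algebraMap K (QuinticAlg K)), map_pow (algebraMap K _),
    mul_assoc]

theorem expLog_mul_expLog_neg [CharZero K] (h : K) : expLog h * expLog (-h) = 1 := by
  rw [expLog_eq_exp, expLog_eq_exp, inv_neg, neg_smul, map_neg, neg_mul]
  exact IsNilpotent.exp_mul_exp_neg_self ⟨4, isNilpotent_C_clsP_mul_X h⟩

theorem expZ_eq_rescale [CharZero K] (a : K) :
    expZ a = PowerSeries.rescale (algebraMap K (QuinticAlg K)[X] a)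
      (PowerSeries.exp (QuinticAlg K)[X]) := by
  ext1 n
  rw [expZ, PowerSeries.coeff_mk, PowerSeries.coeff_rescale, PowerSeries.coeff_exp, one_div,
    algebraMap_rat_eq (K := K), map_mul, map_pow, mul_comm]

theorem exp_C_clsP_mul_X [CharZero K] :
    IsNilpotent.exp (PowerSeries.C (Polynomial.C (clsP K)) * PowerSeries.X :
      (QuinticAlg K)[X]⟦X⟧) = PowerSeries.rescale (Polynomial.C (clsP K))
      (PowerSeries.exp (QuinticAlg K)[X]) := by
  have h4 : (PowerSeries.C (Polynomial.C (clsP K)) * PowerSeries.X :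
      (QuinticAlg K)[X]⟦X⟧) ^ 4 = 0 := by
    rw [mul_pow, ← map_pow, ← Polynomial.C_pow, clsP_pow_four]; simp
  rw [IsNilpotent.exp_eq_sum h4]
  ext1 n
  rw [map_sum, PowerSeries.coeff_rescale, PowerSeries.coeff_exp, one_div]
  have : ∀ i, PowerSeries.coeff n (((i.factorial : ℚ)⁻¹) •
      (PowerSeries.C (Polynomial.C (clsP K)) * PowerSeries.X : (QuinticAlg K)[X]⟦X⟧) ^ i) =
      if n = i then Polynomial.C (clsP K) ^ i *
        algebraMap ℚ (QuinticAlg K)[X] (i.factorial : ℚ)⁻¹ else 0 := fun i => by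
    rw [PowerSeries.coeff_smul, mul_pow, ← map_pow, PowerSeries.coeff_C_mul,
      PowerSeries.coeff_X_pow, Algebra.smul_def]
    split_ifs <;> ring
  simp only [this]
  rw [Finset.sum_ite_eq]
  split_ifs with hn
  · rfl
  · rw [Finset.mem_range, not_lt] at hn
    obtain ⟨m, rfl⟩ := Nat.exists_eq_add_of_le hn
    rw [← Polynomial.C_pow, pow_add (clsP K), clsP_pow_four, zero_mul, map_zero, zero_mul]

/-- The addition law `e^{P(ℓ + hz)/h} = e^{Pℓ/h} e^{Pz}`. -/
theorem eval₂_expLog [CharZero K] {h : K} (hh : h ≠ 0) :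
    (expLog h).eval₂ ((PowerSeries.C (R := (QuinticAlg K)[X])).comp Polynomial.C)
      (PowerSeries.C Polynomial.X +
        PowerSeries.C (algebraMap K (QuinticAlg K)[X] h) * PowerSeries.X) =
    PowerSeries.C (expLog h) * PowerSeries.rescale (Polynomial.C (clsP K))
      (PowerSeries.exp (QuinticAlg K)[X]) := by
  rw [← Polynomial.coe_eval₂RingHom, expLog_eq_exp,
    IsNilpotent.map_exp ⟨4, isNilpotent_C_clsP_mul_X h⟩,
    IsNilpotent.map_exp ⟨4, isNilpotent_C_clsP_mul_X h⟩, ← exp_C_clsP_mul_X,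
    ← IsNilpotent.exp_add_of_commute (Commute.all _ _)]
  · congr 1
    rw [map_mul, Polynomial.coe_eval₂RingHom, Polynomial.eval₂_C, Polynomial.eval₂_X, map_mul,
      mul_add, RingHom.comp_apply, ← mul_assoc, ← map_mul]
    congr 3
    rw [Polynomial.algebraMap_apply, ← map_mul PowerSeries.C, ← Polynomial.C_mul]
    congr 2
    rw [mul_comm, ← Algebra.smul_def, smul_smul, mul_inv_cancel₀ hh, one_smul]
  · exact ⟨4, by rw [← map_pow, isNilpotent_C_clsP_mul_X, map_zero]⟩
  · exact ⟨4, by rw [mul_pow, ← map_pow, ← Polynomial.C_pow, clsP_pow_four]; simp⟩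

/-- The factors `e^{Pℓ/h}` and `e^{-Pℓ/h}` cancel, which removes `ln q`; the others combine to
`e^{Pz} e^{ahz} = e^{(P + ah)z}`, that is, to `e^{pz}` at the pole `p = ah`. -/
theorem coeff_shiftQ_mul_constZ [CharZero K] {h : K} (hh : h ≠ 0) (a b n : ℕ) :
    PowerSeries.coeff n (PowerSeries.coeff a (shiftQ h (ISeries h)) *
      PowerSeries.coeff b (constZ (ISeries (-h)))) =
    Polynomial.C (algebraMap K (QuinticAlg K) (n.factorial : K)⁻¹ *
      (clsP K + algebraMap K (QuinticAlg K) (a * h)) ^ n *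
        (hyperCoeff h a * hyperCoeff (-h) b)) := by
  have e : PowerSeries.coeff a (shiftQ h (ISeries h)) *
      PowerSeries.coeff b (constZ (ISeries (-h))) =
      PowerSeries.C (Polynomial.C (hyperCoeff h a * hyperCoeff (-h) b)) *
      PowerSeries.rescale (Polynomial.C (clsP K + algebraMap K (QuinticAlg K) (a * h)))
        (PowerSeries.exp (QuinticAlg K)[X]) := by
    rw [shiftQ, PowerSeries.coeff_mk, constZ, PowerSeries.coeff_map, coeff_ISeries, coeff_ISeries,
      Polynomial.eval₂_mul, Polynomial.eval₂_C, eval₂_expLog hh, expZ_eq_rescale,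
      map_add Polynomial.C, ← PowerSeries.exp_mul_exp_eq_exp_add, ← Polynomial.algebraMap_apply,
      RingHom.comp_apply, map_mul PowerSeries.C, map_mul Polynomial.C, map_mul PowerSeries.C]
    have h1 : PowerSeries.C (expLog h) * PowerSeries.C (expLog (-h)) = 1 := by
      rw [← map_mul, expLog_mul_expLog_neg, map_one]
    linear_combination PowerSeries.C (Polynomial.C (hyperCoeff h a)) *
      PowerSeries.C (Polynomial.C (hyperCoeff (-h) b)) *
      PowerSeries.rescale (Polynomial.C (clsP K)) (PowerSeries.exp (QuinticAlg K)[X]) *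
      PowerSeries.rescale (algebraMap K (QuinticAlg K)[X] (a * h))
        (PowerSeries.exp (QuinticAlg K)[X]) * h1
  rw [e, PowerSeries.coeff_C_mul, PowerSeries.coeff_rescale, PowerSeries.coeff_exp, one_div,
    algebraMap_rat_eq (K := K), Polynomial.algebraMap_apply, ← Polynomial.C_pow, ← Polynomial.C_mul,
    ← Polynomial.C_mul]
  congr 1
  ring

theorem polyMap_C (f : QuinticAlg K →ₗ[K] K) (y : QuinticAlg K) :
    polyMap f (Polynomial.C y) = Polynomial.C (f y) := by
  ext n
  rw [coeff_polyMap, Polynomial.coeff_C, Polynomial.coeff_C]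
  split_ifs <;> simp

/-- The coefficients of the pairing are residues at infinity of the Euler class. -/
theorem coeff_pairingSeries [CharZero K] {h : K} (hh : h ≠ 0) (d n : ℕ) :
    PowerSeries.coeff n (PowerSeries.coeff d
      (pairingSeries (shiftQ h (ISeries h)) (constZ (ISeries (-h))))) =
    Polynomial.C (resInfty (5 • (Finset.range (d + 1)).val.map fun k : ℕ => (k : K) * h)
      (Polynomial.C (n.factorial : K)⁻¹ * Polynomial.X ^ n * eulerPoly h d)) := by
  rw [pairingSeries, PowerSeries.coeff_mk, PowerSeries.coeff_mk, PowerSeries.coeff_mul, map_sum]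
  simp only [coeff_shiftQ_mul_constZ hh]
  rw [← map_sum, polyMap_C]
  congr 1
  obtain ⟨G, hG⟩ := prod_X_sub_C_dvd_eulerPoly h d
  -- One of the five copies of the weights is set aside to cancel the linear factors of the Euler
  -- class.
  have h5 : (5 • (Finset.range (d + 1)).val.map fun k : ℕ => (k : K) * h) =
      ((Finset.range (d + 1)).val.map fun k : ℕ => (k : K) * h) +
        4 • (Finset.range (d + 1)).val.map fun k : ℕ => (k : K) * h := by
    rw [show 5 = 4 + 1 from rfl, succ_nsmul']
  have hV : ∏ k ∈ Finset.range (d + 1), (Polynomial.X - Polynomial.C ((k : K) * h)) =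
      (((Finset.range (d + 1)).val.map fun k : ℕ => (k : K) * h).map
        fun w => Polynomial.X - Polynomial.C w).prod := by
    rw [Multiset.map_map]; rfl
  have hF : Polynomial.C (n.factorial : K)⁻¹ * Polynomial.X ^ n * eulerPoly h d =
      (((Finset.range (d + 1)).val.map fun k : ℕ => (k : K) * h).map
        fun w => Polynomial.X - Polynomial.C w).prod *
        (Polynomial.C (n.factorial : K)⁻¹ * Polynomial.X ^ n * G) := by
    rw [hG, hV]; ring
  rw [h5, hF, resInfty_prod_mul, resInfty_eq_sum hh,
    Finset.Nat.sum_antidiagonal_eq_sum_range_succ_mk, map_sum]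
  refine Finset.sum_congr rfl fun k hk => ?_
  obtain ⟨b, rfl⟩ : ∃ b, d = k + b := ⟨d - k, by have := Finset.mem_range.mp hk; omega⟩
  rw [Nat.add_sub_cancel_left, map_mul (Polynomial.aeval _) _ G, mul_assoc (Polynomial.aeval _ _),
    aeval_euler_mul_inverse hh k b G hG, map_mul (Polynomial.aeval _),
    map_pow, Polynomial.aeval_C, Polynomial.aeval_X, quinticInt, LinearMap.smul_apply,
    ← map_smul]
  congr 1
  rw [Algebra.smul_def]
  have h5' : algebraMap K (QuinticAlg K) 5 = 5 := map_ofNat _ 5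
  rw [h5']
  ring

end Pairing

/-! ### The linear sigma-model -/

theorem map_range_div_five {α : Type*} (g : ℕ → α) (d : ℕ) :
    (Multiset.range (5 * d)).map (fun a => g (a / 5)) = 5 • (Multiset.range d).map g := by
  induction d with
  | zero => simp
  | succ d ih =>
    rw [show 5 * (d + 1) = 5 * d + 1 + 1 + 1 + 1 + 1 by ring]
    simp only [Multiset.range_succ, Multiset.map_cons, ih]
    rw [show (5 * d + 1 + 1 + 1 + 1) / 5 = d by omega, show (5 * d + 1 + 1 + 1) / 5 = d by omega,
      show (5 * d + 1 + 1) / 5 = d by omega, show (5 * d + 1) / 5 = d by omega,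
      show 5 * d / 5 = d by omega]
    simp only [← Multiset.singleton_add, nsmul_add]
    rw [show 5 • ({g d} : Multiset α) = {g d} + ({g d} + ({g d} + ({g d} + {g d}))) by
      simp only [succ_nsmul, zero_nsmul, zero_add]; abel]
    abel

theorem map_sigmaWeight {α : Type*} (g : ℕ → α) (d : ℕ) :
    (Finset.univ.val.map fun j => g (sigmaWeight d j)) = 5 • (Finset.range (d + 1)).val.map g := by
  have h : (Finset.univ.val.map fun j : Fin (5 * d + 4 + 1) => g (sigmaWeight d j)) =
      (Multiset.range (5 * d + 4 + 1)).map fun a => g (a / 5) := by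
    rw [Fin.univ_val_map]
    change ((List.ofFn fun j : Fin (5 * d + 4 + 1) => (fun a => g (a / 5)) (j : ℕ) : List α) :
      Multiset α) = _
    rw [List.ofFn_eq_map, ← Multiset.coe_range, Multiset.map_coe, ← List.map_coe_finRange_eq_range,
      List.map_map]
    rfl
  exact h.trans (map_range_div_five g (d + 1))

/-- The passage from `ℝ[ħ]` to its fraction field makes the nonzero differences `(k - m)ħ` of the
poles invertible, as partial fractions require. -/
theorem equivIntegral_sigma (d n : ℕ) :
    algebraMap ℝ[X] (RatFunc ℝ)
      (equivIntegral (((n.factorial : ℝ)⁻¹ • pLX d ^ n) * eulerLV d)) =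
    resInfty (5 • (Finset.range (d + 1)).val.map fun k : ℕ => (k : RatFunc ℝ) * RatFunc.X)
      (Polynomial.C (n.factorial : RatFunc ℝ)⁻¹ * Polynomial.X ^ n *
        eulerPoly RatFunc.X d) := by
  set F : ℝ[X][X] := Polynomial.C (Polynomial.C (n.factorial : ℝ)⁻¹) * Polynomial.X ^ n *
    ((List.range (5 * d + 1)).map fun k : ℕ => 5 * Polynomial.X -
      (k : ℝ[X][X]) * Polynomial.C Polynomial.X).prod with hF
  have h1 : ((n.factorial : ℝ)⁻¹ • pLX d ^ n) * eulerLV d = evalP (sigmaWeight d) F := by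
    rw [hF, map_mul, map_mul, map_pow, evalP_X, evalP_C, Polynomial.map_C, map_list_prod,
      List.map_map]
    congr 1
    · rw [Algebra.smul_def]; rfl
    · rw [eulerLV, bind_pure_comp, List.map_eq_map, List.map_map]
      refine congrArg List.prod (List.map_congr_left fun k _ => ?_)
      rw [Function.comp_apply, Function.comp_apply, map_sub, map_mul, map_mul, evalP_X, evalP_C, Polynomial.map_X,
        map_ofNat, map_natCast]
      rfl
  have h2 : F.map (algebraMap ℝ[X] (RatFunc ℝ)) =
      Polynomial.C (n.factorial : RatFunc ℝ)⁻¹ * Polynomial.X ^ n * eulerPoly RatFunc.X d := by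
    rw [hF, Polynomial.map_mul, Polynomial.map_mul, Polynomial.map_pow, Polynomial.map_X,
      Polynomial.map_C, RatFunc.algebraMap_C, map_inv₀, map_natCast]
    congr 1
    rw [← Polynomial.coe_mapRingHom, map_list_prod, List.map_map, eulerPoly, Finset.prod_range,
      ← List.prod_ofFn, List.ofFn_eq_map, ← List.map_coe_finRange_eq_range, List.map_map]
    congr 2
    ext1 k
    simp only [Function.comp_apply, Polynomial.coe_mapRingHom, Polynomial.map_sub,
      Polynomial.map_mul, Polynomial.map_ofNat, Polynomial.map_natCast, Polynomial.map_X,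
      Polynomial.map_C, RatFunc.algebraMap_X, Polynomial.C_mul, map_natCast]
  rw [h1, equivIntegral_evalP, map_resInfty, h2, Multiset.map_map]
  congr 2
  rw [← map_sigmaWeight]
  congr 1
  ext1 j
  simp [RatFunc.algebraMap_X]

/-! ### The intersection pairing -/

theorem pairing_mk {K : Type*} [Field K] (φ ψ : K[X]) :
    pairing (AdjoinRoot.mk _ φ) (AdjoinRoot.mk _ ψ) = 5 * (φ * ψ).coeff 3 := by
  rw [pairing, ← map_mul, quinticInt, LinearMap.smul_apply, comp_mk (by norm_num), smul_eq_mul]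

theorem resInfty_replicate_zero {R : Type*} [CommRing R] (N : ℕ) (F : R[X]) :
    resInfty (Multiset.replicate (N + 1) (0 : R)) F = F.coeff N := by
  suffices h : resInfty (Multiset.replicate (N + 1) (0 : R)) = Polynomial.lcoeff R N from
    LinearMap.congr_fun h F
  ext n
  simp only [LinearMap.comp_apply, Polynomial.lcoeff_apply]
  have h0 : (PowerSeries.mk ((0 : R) ^ ·)) = 1 := by
    ext m
    simp [PowerSeries.coeff_one, zero_pow_eq]
  rw [resInfty_monomial, homSeries, Multiset.map_replicate, h0, Multiset.prod_replicate, one_pow,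
    Multiset.card_replicate, Polynomial.coeff_monomial, PowerSeries.coeff_one]
  by_cases h : n = N
  · simp [h]
  · rw [if_neg h, one_mul]
    split_ifs <;> first | rfl | omega

/-- The same residue formula with all weights zero: the denominator is `p^5`, and the factor `5p`
shifts the extracted coefficient from `p^4` to `p^3`. -/
theorem equivIntegral_pairing (φ ψ : ℝ[X]) :
    equivIntegral (Polynomial.aeval (pForm (N := 4) 0) φ * Polynomial.aeval (pForm (N := 4) 0) ψ *
      (5 * pForm (N := 4) 0)) =
    Polynomial.C (pairing (AdjoinRoot.mk _ φ) (AdjoinRoot.mk _ ψ)) := by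
  have h : ∀ φ : ℝ[X], Polynomial.aeval (pForm (N := 4) 0) φ =
      evalP (N := 4) 0 (φ.map Polynomial.C) := fun φ => by
    induction φ using Polynomial.induction_on' with
    | add p q hp hq => rw [map_add, hp, hq, Polynomial.map_add, map_add]
    | monomial n c =>
      rw [Polynomial.aeval_monomial, Polynomial.map_monomial, ← Polynomial.C_mul_X_pow_eq_monomial,
        map_mul, map_pow, evalP_X, evalP_C, Polynomial.map_C]
      rfl
  have h5 : (5 * pForm (N := 4) 0) = evalP (N := 4) 0 (5 * Polynomial.X) := by
    rw [map_mul, evalP_X, map_ofNat]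
  rw [h, h, h5, ← map_mul, ← map_mul, equivIntegral_evalP, pairing_mk]
  have e : (Finset.univ.val.map fun j : Fin (4 + 1) =>
      Polynomial.C (((0 : Fin (4 + 1) → ℕ) j : ℕ) : ℝ) * Polynomial.X) =
      Multiset.replicate (4 + 1) (0 : ℝ[X]) := by
    simp
  rw [e, resInfty_replicate_zero, ← Polynomial.map_mul, mul_left_comm, ← mul_assoc,
    Polynomial.coeff_mul_X]
  have e5 : (5 : ℝ[X][X]) = Polynomial.C 5 := (map_ofNat _ 5).symm
  rw [e5, Polynomial.coeff_C_mul, Polynomial.coeff_map, Polynomial.C_mul]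
  congr 1

theorem circleIntegral_pow_mul_residue (n : ℕ) :
    (∮ z in C(0, 1), z ^ n * (5 * z / z ^ 5)) =
      if n = 3 then 5 * (2 * (Real.pi : ℂ) * Complex.I) else 0 := by
  have h : (∮ z in C(0, 1), z ^ n * (5 * z / z ^ 5)) =
      ∮ z in C(0, 1), 5 * (z - 0) ^ ((n : ℤ) - 4) := by
    refine circleIntegral.integral_congr zero_le_one fun z hz => ?_
    have hz0 : z ≠ 0 := by
      rintro rfl
      simp at hz
    simp only [sub_zero]
    rw [zpow_sub₀ hz0, zpow_natCast, show (4 : ℤ) = ((4 : ℕ) : ℤ) from rfl, zpow_natCast]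
    field_simp
  rw [h, circleIntegral.integral_const_mul]
  split_ifs with hn
  · subst hn
    have : ∀ z : ℂ, (z - 0) ^ (((3 : ℕ) : ℤ) - 4) = (z - 0)⁻¹ := fun z => by
      rw [show ((3 : ℕ) : ℤ) - 4 = -1 by norm_num, zpow_neg_one]
    simp only [this]
    rw [circleIntegral.integral_sub_center_inv _ one_ne_zero]
  · rw [circleIntegral.integral_sub_zpow_of_ne (by omega), mul_zero]

theorem circleIntegral_pairing (φ ψ : ℝ[X]) :
    (2 * (Real.pi : ℂ) * Complex.I)⁻¹ *
      (∮ P in C(0, 1), Polynomial.aeval P φ * Polynomial.aeval P ψ * (5 * P / P ^ 5)) =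
    (pairing (AdjoinRoot.mk _ φ) (AdjoinRoot.mk _ ψ) : ℝ) := by
  rw [pairing_mk]
  have hpi : (2 * (Real.pi : ℂ) * Complex.I) ≠ 0 := Complex.two_pi_I_ne_zero
  have h : ∀ g : ℝ[X], (CircleIntegrable (fun z : ℂ => Polynomial.aeval z g * (5 * z / z ^ 5)) 0 1) ∧
      (∮ z in C(0, 1), Polynomial.aeval z g * (5 * z / z ^ 5)) =
        (2 * (Real.pi : ℂ) * Complex.I) * (5 * g.coeff 3 : ℝ) := fun g => by
    have hint : ∀ g : ℝ[X],
        CircleIntegrable (fun z : ℂ => Polynomial.aeval z g * (5 * z / z ^ 5)) 0 1 := fun g => by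
      apply ContinuousOn.circleIntegrable zero_le_one
      refine (Polynomial.continuous_aeval g).continuousOn.mul
        (ContinuousOn.div (by fun_prop) (by fun_prop) fun z hz => ?_)
      apply pow_ne_zero
      rintro rfl
      simp at hz
    refine ⟨hint g, ?_⟩
    induction g using Polynomial.induction_on' with
    | add p q hp hq =>
      simp only [map_add, add_mul, Polynomial.coeff_add]
      rw [circleIntegral.integral_add (hint p) (hint q), hp, hq]
      push_cast
      ring
    | monomial n c =>
      have e : ∀ z : ℂ, Polynomial.aeval z (Polynomial.monomial n c) * (5 * z / z ^ 5) =
          (c : ℂ) * (z ^ n * (5 * z / z ^ 5)) := fun z => by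
        rw [Polynomial.aeval_monomial, mul_assoc]; rfl
      simp only [e]
      rw [circleIntegral.integral_const_mul, circleIntegral_pow_mul_residue,
        Polynomial.coeff_monomial]
      split_ifs
      · push_cast; ring
      · simp
  have e : ∀ z : ℂ, Polynomial.aeval z φ * Polynomial.aeval z ψ * (5 * z / z ^ 5) =
      Polynomial.aeval z (φ * ψ) * (5 * z / z ^ 5) := fun z => by rw [map_mul]
  simp only [e]
  rw [(h _).2, inv_mul_cancel_left₀ hpi]

end

end QuinticMirror

/-! ### Assembly of the theorem -/

theorem theoremA :
    -- the intersection pairing: integral over `ℂP^4` and residue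
    (∀ φ ψ : Polynomial ℝ,
      QuinticMirror.equivIntegral
          (Polynomial.aeval (QuinticMirror.pForm (N := 4) 0) φ *
            Polynomial.aeval (QuinticMirror.pForm (N := 4) 0) ψ *
            (5 * QuinticMirror.pForm (N := 4) 0)) =
        Polynomial.C (QuinticMirror.pairing (AdjoinRoot.mk _ φ) (AdjoinRoot.mk _ ψ)) ∧
      (2 * (Real.pi : ℂ) * Complex.I)⁻¹ *
          (∮ P in C(0, 1), Polynomial.aeval P φ * Polynomial.aeval P ψ * (5 * P / P ^ 5)) =
        (QuinticMirror.pairing (AdjoinRoot.mk _ φ) (AdjoinRoot.mk _ ψ) : ℝ)) ∧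
    -- (a)
    PowerSeries.map (PowerSeries.map
        (Polynomial.C.comp (algebraMap (Polynomial ℝ) (RatFunc ℝ)))) QuinticMirror.LSeries =
      QuinticMirror.pairingSeries
        (QuinticMirror.shiftQ (RatFunc.X : RatFunc ℝ) (QuinticMirror.ISeries RatFunc.X))
        (QuinticMirror.constZ (QuinticMirror.ISeries (-RatFunc.X))) ∧
    -- (b)
    (∀ (K : Type*) [Field K] [CharZero K] (h : K), h ≠ 0 →
      LinearIndependent K (QuinticMirror.IComponent h) ∧
      Submodule.span K (Set.range (QuinticMirror.IComponent h)) =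
        QuinticMirror.solutionSpace K) := by
  refine ⟨fun φ ψ => ⟨QuinticMirror.equivIntegral_pairing φ ψ,
    QuinticMirror.circleIntegral_pairing φ ψ⟩, ?_, fun K _ _ h hh =>
    ⟨QuinticMirror.linearIndependent_IComponent hh, QuinticMirror.span_IComponent hh⟩⟩
  have : CharZero (RatFunc ℝ) :=
    charZero_of_injective_algebraMap (algebraMap ℝ (RatFunc ℝ)).injective
  -- Coefficients of `q ^ d z ^ n` are compared in `ℝ(ħ)`. Those on the left are images of
  -- polynomials in `ħ`, so the equality also shows that the right side is polynomial in `ħ` and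
  -- free of `ln q`.
  ext1 d
  ext1 n
  rw [QuinticMirror.coeff_pairingSeries RatFunc.X_ne_zero d n, PowerSeries.coeff_map,
    PowerSeries.coeff_map, ← QuinticMirror.equivIntegral_sigma, QuinticMirror.LSeries,
    PowerSeries.coeff_mk, PowerSeries.coeff_mk, RingHom.comp_apply]
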